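/- Let $Z$ be a real random variable with absolutely continuous law $P_Z$, let $p\ge 1$ and $\gamma>0$, and for $A\ge 0$ let $$\eta(A)=\sup_{P,Q}\frac{D(P*P_Z\,\|\,Q*P_Z)}{D(P\,\|\,Q)},$$ the supremum being over probability measures $P\ne Q$ on $[-A,A]$ with $D(P\|Q)<\infty$ (and $\sup\emptyset=0$), where $D$ is the Kullback--Leibler divergence and $*$ is convolution. Put $$\alpha^*=\inf\Big\{\alpha>0:\ \eta\big(\tfrac1{2\alpha}\big)\le \tfrac13\Big\},$$ and, for $0<t\le\infty$, $$A_2^*=A_2^*(t,\gamma)=\inf\Big\{A>0:\ 18\,\gamma A^{-p}\log(A^p)\le t,\ \ A^p\ge\max\{e,\,2\gamma,\,\alpha^*e^3/\gamma\}\Big\},$$ $$g_d(t,\gamma)=\tfrac12\big(1-\eta(A_2^*)\big)\,t,\qquad g_d(0,\gamma)=0,$$ with natural logarithms and $0\cdot\infty=0$. Then the sets defining $\alpha^*$ and (for every $0<t\le\infty$) $A_2^*$ are nonempty, so that these numbers are finite. Moreover, if $X$ is a real random variable independent of $Z$ with $\mathbb E|X|^p\le\gamma$, $Y=X+Z$,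 and $W$ is a random variable with values in an arbitrary measurable space such that $W\to X\to Y$ is a Markov chain (i.e. $W$ and $Y$ are conditionally independent given $X$), then $$I(W;Y)\le I(W;X)-g_d(I(W;X),\gamma),$$ where the inequality is understood as $I(W;Y)+g_d(I(W;X),\gamma)\le I(W;X)$ in $[0,\infty]$, so that it carries no information if $I(W;X)=\infty$. -/

import Mathlib

open MeasureTheory ProbabilityTheory Set
open scoped ENNReal

/-- The mutual information `I(U;V)`, in nats: the Kullback-Leibler divergence of the joint law of
`(U, V)` from the product of the marginal laws. -/
noncomputable def mutualInfo {Ω 𝒰 𝒱 : Type*} [MeasurableSpace Ω] [MeasurableSpace 𝒰]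
    [MeasurableSpace 𝒱] (U : Ω → 𝒰) (V : Ω → 𝒱) (μ : Measure Ω) : ℝ≥0∞ :=
  InformationTheory.klDiv (μ.map (fun ω => (U ω, V ω))) ((μ.map U).prod (μ.map V))

/-- `W → X → Y` is a Markov chain: `W` and `Y` are conditionally independent given `X`. -/
def IsMarkovChain {Ω 𝒲 𝒳 𝒴 : Type*} [MeasurableSpace Ω] [MeasurableSpace 𝒲]
    [MeasurableSpace 𝒳] [MeasurableSpace 𝒴]
    (W : Ω → 𝒲) (X : Ω → 𝒳) (Y : Ω → 𝒴) (μ : Measure Ω) : Prop :=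
  ∀ (S : Set 𝒲) (T : Set 𝒴), MeasurableSet S → MeasurableSet T →
    μ[(W ⁻¹' S ∩ Y ⁻¹' T).indicator (fun _ => (1 : ℝ)) | MeasurableSpace.comap X inferInstance]
      =ᵐ[μ]
    μ[(W ⁻¹' S).indicator (fun _ => (1 : ℝ)) | MeasurableSpace.comap X inferInstance] *
      μ[(Y ⁻¹' T).indicator (fun _ => (1 : ℝ)) | MeasurableSpace.comap X inferInstance]

/-- The amplitude-constrained KL contraction coefficient `η(A)` of the channel `x ↦ x + Z`, where
`Z` has law `PZ`: the supremum of `D(P ∗ PZ ‖ Q ∗ PZ) / D(P ‖ Q)` over distinct probability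
measures `P`, `Q` on `[-A, A]` with `D(P ‖ Q)` finite (it is positive because `P ≠ Q`). -/
noncomputable def klContraction (PZ : Measure ℝ) (A : ℝ) : ℝ≥0∞ :=
  sSup {r : ℝ≥0∞ | ∃ P Q : Measure ℝ, IsProbabilityMeasure P ∧ IsProbabilityMeasure Q ∧
    P (Icc (-A) A) = 1 ∧ Q (Icc (-A) A) = 1 ∧ P ≠ Q ∧ InformationTheory.klDiv P Q ≠ ∞ ∧
    r = InformationTheory.klDiv (P.conv PZ) (Q.conv PZ) / InformationTheory.klDiv P Q}

/-- The set of `α > 0` with `η(1 / (2α)) ≤ 1/3`. -/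
def alphaSet (PZ : Measure ℝ) : Set ℝ :=
  {α : ℝ | 0 < α ∧ klContraction PZ (1 / (2 * α)) ≤ 1 / 3}

/-- `α^*`, the infimum of `alphaSet`. -/
noncomputable def alphaStar (PZ : Measure ℝ) : ℝ := sInf (alphaSet PZ)

/-- The set of amplitudes `A > 0` with `18 γ A^{-p} log (A^p) ≤ t` and
`A^p ≥ max {e, 2γ, α^* e^3 / γ}`. The second condition makes the left side of the first one
nonnegative when `γ > 0`, so that `ENNReal.ofReal` does not truncate. -/
noncomputable def amplitudeSet (PZ : Measure ℝ) (p γ : ℝ) (t : ℝ≥0∞) : Set ℝ :=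
  {A : ℝ | 0 < A ∧ ENNReal.ofReal (18 * γ * A ^ (-p) * Real.log (A ^ p)) ≤ t ∧
    max (Real.exp 1) (max (2 * γ) (alphaStar PZ * Real.exp 3 / γ)) ≤ A ^ p}

/-- `A₂^*`, the infimum of `amplitudeSet`. -/
noncomputable def amplitudeStar (PZ : Measure ℝ) (p γ : ℝ) (t : ℝ≥0∞) : ℝ :=
  sInf (amplitudeSet PZ p γ t)

/-- `g_d(t, γ) = (1/2) (1 - η(A₂^*)) t`. By data processing `η ≤ 1`, so the subtraction is the
ordinary one; at `t = 0` the value is `0` whatever `A₂^*` is. -/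
noncomputable def diagonalGap (PZ : Measure ℝ) (p γ : ℝ) (t : ℝ≥0∞) : ℝ≥0∞ :=
  1 / 2 * (1 - klContraction PZ (amplitudeStar PZ p γ t)) * t

/-! Cut the input line into the core `[-A, A]` and short cells of length `1 / α` outside it, and let
`B` be the cell index of `X`. Inside the core the channel contracts divergence by `η(A)`. Inside a
short cell it contracts by `1/3`, once `α` exceeds `α^*`, because `η` does not see translations.
With `e = max (η(A)) (1/3)`, the chain rule on both sides of the channel gives `I(W;Y) ≤ I(W;B) + e
I(W;X | B) = e I(W;X) + (1 - e) I(W;B)`, and `I(W;B) ≤ H(B)` (`klDiv_conv_le_of_partition`,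
`lintegral_klDiv_comp_le_entropy`).

The moment bound makes `H(B)` of order `γ A^{-p} log (A^p)` (`entropy_tailCell_le`). The choice of
`A₂^*` brings this below `I(W;X) / 4`, and `add_diagonal_gap_le` is the remaining arithmetic.

That some `α` satisfies `η(1 / (2α)) ≤ 1/3` is where absolute continuity of the noise enters.
Translates of an `L¹` density are close in total variation, and total variation controls the
contraction of divergence (`klDiv_conv_le_dobrushin_mul`), since `klFun` is a mixture of
hockey-stick functions. -/

open InformationTheory

/-! ### Conditional divergence as an integral over kernels -/

section ChainRule

variable {α β : Type*} [MeasurableSpace α] [MeasurableSpace β]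

lemma klDiv_withDensity_left (ν : Measure β) [IsFiniteMeasure ν] {f : β → ℝ≥0∞}
    (hf : Measurable f) [IsFiniteMeasure (ν.withDensity f)] :
    klDiv (ν.withDensity f) ν = ∫⁻ x, ENNReal.ofReal (klFun (f x).toReal) ∂ν := by
  rw [klDiv_eq_lintegral_klFun_of_ac (withDensity_absolutelyContinuous ν f)]
  refine lintegral_congr_ae ?_
  filter_upwards [Measure.rnDeriv_withDensity ν hf] with x hx
  rw [hx]

variable [MeasurableSpace.CountableOrCountablyGenerated α β]

lemma klDiv_kernel_of_ac (κ η : Kernel α β) [IsFiniteKernel κ] [IsFiniteKernel η] {a : α}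
    (h : κ a ≪ η a) :
    klDiv (κ a) (η a) = ∫⁻ x, ENNReal.ofReal (klFun (κ.rnDeriv η a x).toReal) ∂(η a) := by
  rw [klDiv_eq_lintegral_klFun_of_ac h]
  refine lintegral_congr_ae ?_
  filter_upwards [Kernel.rnDeriv_eq_rnDeriv_measure (κ := κ) (η := η) (a := a)] with x hx
  rw [hx]

/-- `Kernel.rnDeriv` is a jointly measurable density, available when the source is countable or the
target countably generated. The targets used are `ℝ` and countable spaces, so `W` may live in any
measurable space. -/
lemma measurable_klDiv_kernel (κ η : Kernel α β) [IsFiniteKernel κ] [IsFiniteKernel η] :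
    Measurable fun a => klDiv (κ a) (η a) := by
  classical
  have : (fun a => klDiv (κ a) (η a)) = fun a => if κ a ≪ η a then
      ∫⁻ x, ENNReal.ofReal (klFun (κ.rnDeriv η a x).toReal) ∂(η a) else ∞ := by
    ext a
    split_ifs with h
    · exact klDiv_kernel_of_ac κ η h
    · exact klDiv_of_not_ac h
  rw [this]
  refine Measurable.ite (Kernel.measurableSet_absolutelyContinuous κ η) ?_ measurable_const
  have hm : Measurable (Function.uncurry fun (a : α) (x : β) =>
      ENNReal.ofReal (klFun (κ.rnDeriv η a x).toReal)) :=
    (measurable_klFun.comp (Kernel.measurable_rnDeriv κ η).ennreal_toReal).ennreal_ofReal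
  exact hm.lintegral_kernel_prod_right

/-- Integral form of the conditional Kullback-Leibler divergence. -/
theorem klDiv_compProd_right (μ : Measure α) [IsFiniteMeasure μ] (κ η : Kernel α β)
    [IsFiniteKernel κ] [IsFiniteKernel η] :
    klDiv (μ ⊗ₘ κ) (μ ⊗ₘ η) = ∫⁻ a, klDiv (κ a) (η a) ∂μ := by
  by_cases hac : ∀ᵐ a ∂μ, κ a ≪ η a
  · have hm : Measurable fun p : α × β => κ.rnDeriv η p.1 p.2 := Kernel.measurable_rnDeriv κ η
    have hd : μ ⊗ₘ κ = (μ ⊗ₘ η).withDensity fun p => κ.rnDeriv η p.1 p.2 := by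
      ext s hs
      rw [withDensity_apply _ hs, ← lintegral_indicator hs,
        Measure.lintegral_compProd (hm.indicator hs), Measure.compProd_apply hs]
      refine lintegral_congr_ae ?_
      filter_upwards [hac] with a ha
      have hs' := measurable_prodMk_left (x := a) hs
      rw [← Kernel.setLIntegral_rnDeriv ha hs', ← lintegral_indicator hs']
      rfl
    have : IsFiniteMeasure ((μ ⊗ₘ η).withDensity fun p => κ.rnDeriv η p.1 p.2) := by
      rw [← hd]; infer_instance
    have hk : Measurable fun p : α × β => ENNReal.ofReal (klFun (κ.rnDeriv η p.1 p.2).toReal) :=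
      (measurable_klFun.comp hm.ennreal_toReal).ennreal_ofReal
    rw [hd, klDiv_withDensity_left _ hm, Measure.lintegral_compProd hk]
    refine lintegral_congr_ae ?_
    filter_upwards [hac] with a ha
    rw [klDiv_kernel_of_ac κ η ha]
  · rw [klDiv_of_not_ac (fun h => hac (Measure.absolutelyContinuous_compProd_right_iff.1 h))]
    -- A finite integral would make almost every `klDiv (κ a) (η a)` finite, hence `κ a ≪ η a`
    -- almost everywhere.
    by_contra hne
    refine hac ?_
    filter_upwards [ae_lt_top (measurable_klDiv_kernel κ η) (Ne.symm hne)] with a ha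
    exact (klDiv_ne_top_iff.1 ha.ne).1

end ChainRule

/-! ### The contraction coefficient and the additive-noise kernel -/

lemma klDiv_map_measurableEquiv {α β : Type*} [MeasurableSpace α] [MeasurableSpace β]
    (μ ν : Measure α) [IsFiniteMeasure μ] [IsFiniteMeasure ν] (e : α ≃ᵐ β) :
    klDiv (μ.map e) (ν.map e) = klDiv μ ν := by
  refine le_antisymm (klDiv_map_le _ _ e.measurable) ?_
  have h := klDiv_map_le (μ.map e) (ν.map e) e.symm.measurable
  rwa [Measure.map_map e.symm.measurable e.measurable, Measure.map_map e.symm.measurable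
    e.measurable, MeasurableEquiv.symm_comp_self, Measure.map_id, Measure.map_id] at h

lemma map_add_const_conv (P PZ : Measure ℝ) [SFinite P] [SFinite PZ] (c : ℝ) :
    (P.map (fun x => x + c)).conv PZ = (P.conv PZ).map (fun x => x + c) := by
  ext s hs
  simp only [Measure.conv]
  have h1 : Measurable fun x : ℝ => x + c := by fun_prop
  have h2 : Measurable fun p : ℝ × ℝ => p.1 + p.2 := by fun_prop
  have : SFinite (P.map fun x => x + c) := inferInstance
  rw [Measure.map_map h1 h2]
  conv_lhs => rw [← Measure.map_id (μ := PZ)]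
  rw [Measure.map_prod_map P PZ h1 measurable_id, Measure.map_map h2 (by fun_prop)]
  congr 2
  ext p
  simp only [Function.comp, Prod.map, id]
  ring

/-- Translation commutes with convolution and preserves divergence, so the centre of the interval is
irrelevant. The pair `P = Q`, excluded from the supremum, is trivial. -/
lemma klDiv_conv_le_klContraction_mul (PZ : Measure ℝ) [IsProbabilityMeasure PZ] (A c : ℝ)
    (P Q : Measure ℝ) [IsProbabilityMeasure P] [IsProbabilityMeasure Q]
    (hP : P (Icc (c - A) (c + A)) = 1) (hQ : Q (Icc (c - A) (c + A)) = 1) (h : klDiv P Q ≠ ∞) :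
    klDiv (P.conv PZ) (Q.conv PZ) ≤ klContraction PZ A * klDiv P Q := by
  by_cases hPQ : P = Q
  · subst hPQ
    simp [klDiv_self]
  have hm : Measurable fun x : ℝ => x + -c := by fun_prop
  have hcoe : ⇑(MeasurableEquiv.addRight (-c)) = fun x : ℝ => x + -c := rfl
  have e1 : ∀ M N : Measure ℝ, IsFiniteMeasure M → IsFiniteMeasure N →
      klDiv (M.map fun x => x + -c) (N.map fun x => x + -c) = klDiv M N := by
    intro M N _ _
    rw [← hcoe, klDiv_map_measurableEquiv]
  have hpre : (fun x : ℝ => x + -c) ⁻¹' (Icc (-A) A) = Icc (c - A) (c + A) := by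
    ext x
    simp only [mem_preimage, mem_Icc]
    constructor <;> rintro ⟨h1, h2⟩ <;> constructor <;> linarith
  have hd : klDiv P Q ≠ 0 := fun h0 => hPQ (klDiv_eq_zero_iff.1 h0)
  have hr : klDiv (P.conv PZ) (Q.conv PZ) / klDiv P Q ≤ klContraction PZ A := by
    refine le_sSup ⟨P.map fun x => x + -c, Q.map fun x => x + -c,
      Measure.isProbabilityMeasure_map hm.aemeasurable,
      Measure.isProbabilityMeasure_map hm.aemeasurable, ?_, ?_, ?_, ?_, ?_⟩
    · rw [Measure.map_apply hm measurableSet_Icc, hpre, hP]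
    · rw [Measure.map_apply hm measurableSet_Icc, hpre, hQ]
    · intro heq
      apply hd
      rw [← e1 P Q inferInstance inferInstance, heq]
      have : IsFiniteMeasure (Q.map fun x => x + -c) := inferInstance
      exact klDiv_self _
    · rwa [e1 P Q inferInstance inferInstance]
    · rw [map_add_const_conv, map_add_const_conv, e1 _ _ inferInstance inferInstance,
        e1 _ _ inferInstance inferInstance]
  calc klDiv (P.conv PZ) (Q.conv PZ)
      = klDiv (P.conv PZ) (Q.conv PZ) / klDiv P Q * klDiv P Q :=
        (ENNReal.div_mul_cancel hd h).symm
    _ ≤ _ := by gcongr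

lemma klContraction_mono (PZ : Measure ℝ) {A A' : ℝ} (h : A ≤ A') :
    klContraction PZ A ≤ klContraction PZ A' := by
  refine sSup_le_sSup ?_
  rintro r ⟨P, Q, iP, iQ, hP, hQ, hr⟩
  have hsub : Icc (-A) A ⊆ Icc (-A') A' := Icc_subset_Icc (by linarith) h
  exact ⟨P, Q, iP, iQ, le_antisymm prob_le_one (hP ▸ measure_mono hsub),
    le_antisymm prob_le_one (hQ ▸ measure_mono hsub), hr⟩

/-- The additive-noise channel `x ↦ law of x + Z`. -/
noncomputable def addNoise (PZ : Measure ℝ) : Kernel ℝ ℝ :=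
  (Kernel.id ×ₖ Kernel.const ℝ PZ).map fun p => p.1 + p.2

instance (PZ : Measure ℝ) [IsProbabilityMeasure PZ] : IsMarkovKernel (addNoise PZ) :=
  Kernel.IsMarkovKernel.map _ (by fun_prop)

lemma addNoise_apply (PZ : Measure ℝ) [SFinite PZ] (x : ℝ) :
    addNoise PZ x = PZ.map fun z => x + z := by
  rw [addNoise, Kernel.map_apply _ (by fun_prop), Kernel.prod_apply, Kernel.id_apply,
    Kernel.const_apply, Measure.dirac_prod, Measure.map_map (by fun_prop) (by fun_prop)]
  rfl

lemma bind_addNoise (PZ P : Measure ℝ) [SFinite PZ] [SFinite P] :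
    P.bind (addNoise PZ) = P.conv PZ := by
  ext s hs
  rw [Measure.bind_apply hs (Kernel.aemeasurable _), Measure.conv,
    Measure.map_apply (by fun_prop) hs, Measure.prod_apply (measurable_add hs)]
  refine lintegral_congr fun x => ?_
  rw [addNoise_apply, Measure.map_apply (by fun_prop) hs]
  rfl

lemma addNoise_comp_apply {α : Type*} [MeasurableSpace α] (PZ : Measure ℝ) [SFinite PZ]
    (κ : Kernel α ℝ) [IsSFiniteKernel κ] (a : α) :
    (addNoise PZ ∘ₖ κ) a = (κ a).conv PZ := by
  rw [Kernel.comp_apply, bind_addNoise]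

lemma klDiv_conv_le (PZ P Q : Measure ℝ) [IsProbabilityMeasure PZ] [IsProbabilityMeasure P]
    [IsProbabilityMeasure Q] : klDiv (P.conv PZ) (Q.conv PZ) ≤ klDiv P Q := by
  rw [← bind_addNoise, ← bind_addNoise]
  exact klDiv_comp_right_le _ _ _

/-! ### Contraction along a countable partition -/

lemma ae_condDistrib_id_fiber (P : Measure ℝ) [IsProbabilityMeasure P] {B : ℝ → ℤ}
    (hB : Measurable B) : ∀ᵐ b ∂(P.map B), condDistrib id B P b (B ⁻¹' {b}) = 1 := by
  have h : P.map B ⊗ₘ condDistrib id B P = P.map fun x => (B x, x) :=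
    compProd_map_condDistrib aemeasurable_id
  have hae : ∀ᵐ q ∂(P.map B ⊗ₘ condDistrib id B P), B q.2 = q.1 := by
    have hs : MeasurableSet {q : ℤ × ℝ | B q.2 = q.1} :=
      measurableSet_eq_fun (hB.comp measurable_snd) measurable_fst
    have hpair : Measurable fun x : ℝ => (B x, x) := hB.prodMk measurable_id
    rw [h, ae_map_iff hpair.aemeasurable hs]
    exact ae_of_all _ fun x => rfl
  filter_upwards [Measure.ae_ae_of_ae_compProd hae] with b hb
  exact prob_compl_eq_zero_iff (hB (measurableSet_singleton b)) |>.1 hb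

/-- Decomposition of the divergence along a countable partition `B` of the input space, on each
cell of which the channel contracts the divergence by the factor `e`. -/
lemma klDiv_conv_le_of_partition (PZ P Q : Measure ℝ) [IsProbabilityMeasure PZ]
    [IsProbabilityMeasure P] [IsProbabilityMeasure Q] {B : ℝ → ℤ} (hB : Measurable B)
    {e : ℝ≥0∞} (he : e ≤ 1)
    (hcell : ∀ b, ∀ P' Q' : Measure ℝ, IsProbabilityMeasure P' → IsProbabilityMeasure Q' →
      P' (B ⁻¹' {b}) = 1 → Q' (B ⁻¹' {b}) = 1 → klDiv P' Q' ≠ ∞ →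
      klDiv (P'.conv PZ) (Q'.conv PZ) ≤ e * klDiv P' Q')
    (hfin : klDiv P Q ≠ ∞) :
    klDiv (P.conv PZ) (Q.conv PZ) ≤
      e * klDiv P Q + (1 - e) * klDiv (P.map B) (Q.map B) := by
  have : IsProbabilityMeasure (P.map B) := Measure.isProbabilityMeasure_map hB.aemeasurable
  have : IsProbabilityMeasure (Q.map B) := Measure.isProbabilityMeasure_map hB.aemeasurable
  set κ := condDistrib id B P with hκ
  set η := condDistrib id B Q with hη
  have hpair : Measurable fun x : ℝ => (B x, x) := hB.prodMk measurable_id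
  have hjP : P.map B ⊗ₘ κ = P.map fun x => (B x, x) := compProd_map_condDistrib aemeasurable_id
  have hjQ : Q.map B ⊗ₘ η = Q.map fun x => (B x, x) := compProd_map_condDistrib aemeasurable_id
  have hsnd : ∀ M : Measure ℝ, (M.map fun x => (B x, x)).map Prod.snd = M := fun M => by
    rw [Measure.map_map measurable_snd hpair]
    exact Measure.map_id
  -- The maps `x ↦ (B x, x)` and `Prod.snd` undo each other, so data processing in both directions
  -- equates the divergences of `x` and of the pair.
  have hchain : klDiv P Q =
      klDiv (P.map B) (Q.map B) + ∫⁻ b, klDiv (κ b) (η b) ∂(P.map B) := by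
    rw [← klDiv_compProd_right, ← klDiv_compProd_eq_add, hjP, hjQ]
    refine le_antisymm ?_ (klDiv_map_le _ _ hpair)
    have h := klDiv_map_le (P.map fun x => (B x, x)) (Q.map fun x => (B x, x))
      measurable_snd
    rwa [hsnd, hsnd] at h
  -- Keep the cell index next to the channel output, apply the chain rule to the pair, and forget
  -- the index by data processing.
  have hout : klDiv (P.conv PZ) (Q.conv PZ) ≤ klDiv (P.map B) (Q.map B) +
      ∫⁻ b, klDiv ((κ b).conv PZ) ((η b).conv PZ) ∂(P.map B) := by
    have h1 : ∀ (M : Measure ℝ) (ρ : Kernel ℤ ℝ), IsProbabilityMeasure M → IsMarkovKernel ρ →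
        M.map B ⊗ₘ ρ = M.map (fun x => (B x, x)) →
        M.conv PZ = (M.map B ⊗ₘ (addNoise PZ ∘ₖ ρ)).map Prod.snd := by
      intro M ρ _ _ hM
      have h2 : (M.map B ⊗ₘ (addNoise PZ ∘ₖ ρ)).map Prod.snd =
          (M.map B).bind (addNoise PZ ∘ₖ ρ) := Measure.snd_compProd _ _
      have h3 : M = (M.map B).bind ρ := by
        rw [← Measure.snd_compProd, hM, Measure.snd, hsnd]
      rw [h2, ← Measure.comp_assoc, ← h3, bind_addNoise]
    rw [h1 P κ inferInstance inferInstance hjP, h1 Q η inferInstance inferInstance hjQ]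
    refine (klDiv_map_le _ _ measurable_snd).trans ?_
    rw [klDiv_compProd_eq_add, klDiv_compProd_right]
    simp_rw [addNoise_comp_apply]
    exact le_rfl
  have hR : ∫⁻ b, klDiv (κ b) (η b) ∂(P.map B) ≠ ∞ := by
    rw [hchain] at hfin
    exact (ENNReal.add_ne_top.1 hfin).2
  have hacB : P.map B ≪ Q.map B := (klDiv_ne_top_iff.1 hfin).1.map hB
  have hcomp : ∫⁻ b, klDiv ((κ b).conv PZ) ((η b).conv PZ) ∂(P.map B) ≤
      e * ∫⁻ b, klDiv (κ b) (η b) ∂(P.map B) := by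
    rw [← lintegral_const_mul _ (measurable_klDiv_kernel κ η)]
    refine lintegral_mono_ae ?_
    -- Concentration of `η b` on its cell is known only `Q.map B`-almost everywhere; it transfers
    -- through `P.map B ≪ Q.map B`.
    filter_upwards [ae_condDistrib_id_fiber P hB, hacB.ae_le (ae_condDistrib_id_fiber Q hB),
      ae_lt_top (measurable_klDiv_kernel κ η) hR] with b h1 h2 h3
    exact hcell b _ _ inferInstance inferInstance h1 h2 h3.ne
  calc klDiv (P.conv PZ) (Q.conv PZ)
      ≤ (e + (1 - e)) * klDiv (P.map B) (Q.map B) +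
          e * ∫⁻ b, klDiv (κ b) (η b) ∂(P.map B) := by
        rw [add_tsub_cancel_of_le he, one_mul]
        exact hout.trans (by gcongr)
    _ = e * klDiv P Q + (1 - e) * klDiv (P.map B) (Q.map B) := by
        rw [hchain]
        ring

/-! ### Hockey-stick representation and kernel contraction -/

section HockeyStick

lemma lintegral_Ioi_eq_ofReal_intervalIntegral {F : ℝ → ℝ≥0∞} {φ : ℝ → ℝ} {a b : ℝ} (ha : 0 ≤ a)
    (hab : a ≤ b) (h0 : ∀ s, 0 < s → s ∉ Ioc a b → F s = 0)
    (h1 : ∀ s ∈ Ioc a b, F s = ENNReal.ofReal (φ s)) (hφ : ∀ s ∈ Ioc a b, 0 ≤ φ s)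
    (hint : IntervalIntegrable φ volume a b) :
    ∫⁻ s in Ioi (0 : ℝ), F s = ENNReal.ofReal (∫ s in a..b, φ s) := by
  have h2 : ∫⁻ s in Ioi (0 : ℝ), F s = ∫⁻ s in Ioi (0 : ℝ), (Ioc a b).indicator F s := by
    refine setLIntegral_congr_fun measurableSet_Ioi fun s hs => ?_
    by_cases hs' : s ∈ Ioc a b
    · simp [hs']
    · simp [hs', h0 s hs hs']
  have hsub : Ioc a b ∩ Ioi 0 = Ioc a b :=
    inter_eq_left.2 fun s hs => lt_of_le_of_lt ha hs.1
  rw [h2, lintegral_indicator measurableSet_Ioc, Measure.restrict_restrict measurableSet_Ioc, hsub,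
    setLIntegral_congr_fun measurableSet_Ioc h1, intervalIntegral.integral_of_le hab,
    ofReal_integral_eq_lintegral_ofReal]
  · exact (intervalIntegrable_iff_integrableOn_Ioc_of_le hab).1 hint
  · exact (ae_restrict_iff' measurableSet_Ioc).2 (ae_of_all _ hφ)

/-- `klFun` as a mixture of hockey-stick functions. -/
lemma ofReal_klFun_eq_lintegral {t : ℝ} (ht : 0 ≤ t) :
    ENNReal.ofReal (klFun t) = ∫⁻ s in Ioi (0 : ℝ), ENNReal.ofReal s⁻¹ *
      (if 1 < s then ENNReal.ofReal (t - s) else ENNReal.ofReal (s - t)) := by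
  symm
  have hinv : ∀ a b : ℝ, 0 < a → a ≤ b → IntervalIntegrable (fun s : ℝ => s⁻¹) volume a b :=
    fun a b ha hab => intervalIntegral.intervalIntegrable_inv
      (fun x hx => by rw [uIcc_of_le hab] at hx; exact (ha.trans_le hx.1).ne') continuousOn_id
  -- Truncation in `ENNReal.ofReal` kills the integrand except for `s` between `1` and `t`; there
  -- the integral is elementary and equals `t log t - t + 1`.
  rcases le_or_gt 1 t with h1 | h1
  · rw [lintegral_Ioi_eq_ofReal_intervalIntegral (φ := fun s => t * s⁻¹ - 1) zero_le_one h1]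
    · rw [intervalIntegral.integral_sub ((hinv 1 t one_pos h1).const_mul t)
        intervalIntegrable_const, intervalIntegral.integral_const_mul,
        integral_inv_of_pos one_pos (by linarith), intervalIntegral.integral_const, klFun_apply]
      congr 1
      simp
      ring
    · intro s hs hs'
      rw [mem_Ioc, not_and_or] at hs'
      split_ifs with h
      · rw [ENNReal.ofReal_of_nonpos (p := t - s), mul_zero]
        rcases hs' with h' | h' <;> linarith
      · rw [ENNReal.ofReal_of_nonpos (p := s - t), mul_zero]
        linarith
    · intro s hs
      have : 0 < s := by linarith [hs.1]
      rw [if_pos hs.1, ← ENNReal.ofReal_mul (by positivity)]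
      congr 1
      field_simp
    · intro s hs
      have : 0 < s := by linarith [hs.1]
      rw [← div_eq_mul_inv, sub_nonneg, le_div_iff₀ this]
      linarith [hs.2]
    · exact ((hinv 1 t one_pos h1).const_mul t).sub intervalIntegrable_const
  · have hφ : IntervalIntegrable (fun s => 1 - t * s⁻¹) volume t 1 ∧
        ∫ s in t..1, (1 - t * s⁻¹) = klFun t := by
      rcases ht.eq_or_lt with rfl | h0
      · simp [klFun_zero]
      · refine ⟨intervalIntegrable_const.sub ((hinv t 1 h0 h1.le).const_mul t), ?_⟩
        rw [intervalIntegral.integral_sub intervalIntegrable_const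
          ((hinv t 1 h0 h1.le).const_mul t), intervalIntegral.integral_const_mul,
          integral_inv_of_pos h0 one_pos, intervalIntegral.integral_const, klFun_apply]
        simp
        ring
    rw [lintegral_Ioi_eq_ofReal_intervalIntegral (φ := fun s => 1 - t * s⁻¹) ht h1.le, hφ.2]
    · intro s hs hs'
      rw [mem_Ioc, not_and_or] at hs'
      split_ifs with h
      · rw [ENNReal.ofReal_of_nonpos (p := t - s), mul_zero]
        linarith
      · rw [ENNReal.ofReal_of_nonpos (p := s - t), mul_zero]
        rcases hs' with h' | h' <;> linarith
    · intro s hs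
      have : 0 < s := by linarith [hs.1]
      rw [if_neg (not_lt.2 hs.2), ← ENNReal.ofReal_mul (by positivity)]
      congr 1
      field_simp
    · intro s hs
      have : 0 < s := by linarith [hs.1]
      rw [← div_eq_mul_inv, sub_nonneg, div_le_iff₀ this]
      linarith [hs.1]
    · exact hφ.1

variable {α β : Type*} [MeasurableSpace α] [MeasurableSpace β]

/-- Truncated subtraction is the positive part, and Tonelli exchanges `s` and `x`. When `ν` and
`ν.withDensity g` are probability measures, the switch at `s = 1` makes the function subtracted from
the one with the smaller mass, as the kernel bound below requires. -/
lemma klDiv_withDensity_eq_lintegral_hockeyStick (ν : Measure β) [IsFiniteMeasure ν]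
    {g : β → ℝ≥0∞} (hg : Measurable g) [IsFiniteMeasure (ν.withDensity g)] :
    klDiv (ν.withDensity g) ν = ∫⁻ s in Ioi (0 : ℝ), ENNReal.ofReal s⁻¹ *
      (if 1 < s then ∫⁻ x, (g x - ENNReal.ofReal s) ∂ν
        else ∫⁻ x, (ENNReal.ofReal s - g x) ∂ν) := by
  have hfin : ∀ᵐ x ∂ν, g x < ∞ := ae_lt_top hg (by
    rw [← setLIntegral_univ, ← withDensity_apply _ MeasurableSet.univ]
    exact measure_ne_top _ _)
  have hm : Measurable (Function.uncurry fun (x : β) (s : ℝ) => ENNReal.ofReal s⁻¹ *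
      (if 1 < s then (g x - ENNReal.ofReal s) else (ENNReal.ofReal s - g x))) := by
    refine Measurable.mul (by fun_prop) (Measurable.ite ?_ (by fun_prop) (by fun_prop))
    exact measurableSet_lt measurable_const measurable_snd
  calc klDiv (ν.withDensity g) ν
      = ∫⁻ x, (∫⁻ s in Ioi (0 : ℝ), ENNReal.ofReal s⁻¹ *
          (if 1 < s then (g x - ENNReal.ofReal s) else (ENNReal.ofReal s - g x))) ∂ν := by
        rw [klDiv_withDensity_left ν hg]
        refine lintegral_congr_ae ?_
        filter_upwards [hfin] with x hx
        rw [ofReal_klFun_eq_lintegral ENNReal.toReal_nonneg]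
        refine setLIntegral_congr_fun measurableSet_Ioi fun s (hs : 0 < s) => ?_
        rw [ENNReal.ofReal_sub _ hs.le, ENNReal.ofReal_sub _ ENNReal.toReal_nonneg,
          ENNReal.ofReal_toReal hx.ne]
    _ = ∫⁻ s in Ioi (0 : ℝ), ∫⁻ x, ENNReal.ofReal s⁻¹ *
          (if 1 < s then (g x - ENNReal.ofReal s) else (ENNReal.ofReal s - g x)) ∂ν :=
        lintegral_lintegral_swap hm.aemeasurable
    _ = _ := by
        refine lintegral_congr fun s => ?_
        split_ifs with h
        · rw [lintegral_const_mul _ (by fun_prop)]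
        · rw [lintegral_const_mul _ (by fun_prop)]

variable {Q : Measure α} [IsFiniteMeasure Q] {ν : Measure β} [SFinite ν] {k : α → β → ℝ≥0∞}
  {ε : ℝ≥0∞}

/-- Product-coupling argument: after multiplication by `b = ∫ v`, the difference is at most the
integral of `u x * v x' * (k x y - k x' y)` over pairs `(x, x')`. Integrating over `y` first costs
at most `ε` per pair, and `b` cancels. -/
lemma lintegral_sub_lintegral_kernel_le_of_le (hk : Measurable (Function.uncurry k))
    (hε : ∀ᵐ z ∂(Q.prod Q), ∫⁻ y, (k z.1 y - k z.2 y) ∂ν ≤ ε)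
    {u v : α → ℝ≥0∞} (hu : Measurable u) (hv : Measurable v)
    (huv : ∫⁻ x, u x ∂Q ≤ ∫⁻ x, v x ∂Q) (hvfin : ∫⁻ x, v x ∂Q ≠ ∞) :
    ∫⁻ y, (∫⁻ x, u x * k x y ∂Q - ∫⁻ x, v x * k x y ∂Q) ∂ν ≤ ε * ∫⁻ x, u x ∂Q := by
  have hk1 : ∀ y, Measurable fun x => k x y := fun y => hk.comp measurable_prodMk_right
  have hk2 : ∀ x, Measurable fun y => k x y := fun x => hk.comp measurable_prodMk_left
  have hK : ∀ w : α → ℝ≥0∞, Measurable w → Measurable fun y => ∫⁻ x, w x * k x y ∂Q := by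
    intro w hw
    refine Measurable.lintegral_prod_left' (f := fun z : α × β => w z.1 * k z.1 z.2) ?_
    exact (hw.comp measurable_fst).mul hk
  set b := ∫⁻ x, v x ∂Q with hb
  by_cases hb0 : b = 0
  · have hu0 : u =ᵐ[Q] 0 := by
      rw [← lintegral_eq_zero_iff hu]
      exact le_antisymm (huv.trans hb0.le) zero_le
    have : ∀ y, ∫⁻ x, u x * k x y ∂Q = 0 := by
      intro y
      have := hk1 y
      rw [lintegral_eq_zero_iff (by fun_prop)]
      filter_upwards [hu0] with x hx
      simp [hx]
    simp [this]
  rw [← ENNReal.mul_le_mul_iff_right hb0 hvfin, ← lintegral_const_mul _ (by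
    exact (hK u hu).sub (hK v hv))]
  have hm3 : Measurable fun z : (α × α) × β => u z.1.1 * v z.1.2 * (k z.1.1 z.2 - k z.1.2 z.2) := by
    have e1 : Measurable fun z : (α × α) × β => k z.1.1 z.2 :=
      hk.comp ((measurable_fst.comp measurable_fst).prodMk measurable_snd)
    have e2 : Measurable fun z : (α × α) × β => k z.1.2 z.2 :=
      hk.comp ((measurable_snd.comp measurable_fst).prodMk measurable_snd)
    fun_prop
  have hpt : ∀ y, b * (∫⁻ x, u x * k x y ∂Q - ∫⁻ x, v x * k x y ∂Q) ≤
      ∫⁻ z, u z.1 * v z.2 * (k z.1 y - k z.2 y) ∂(Q.prod Q) := by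
    intro y
    have e1 : b * ∫⁻ x, u x * k x y ∂Q = ∫⁻ z, u z.1 * k z.1 y * v z.2 ∂(Q.prod Q) := by
      rw [lintegral_prod_mul (f := fun x => u x * k x y) (hu.mul (hk1 y)).aemeasurable
        hv.aemeasurable, mul_comm]
    have e2 : (∫⁻ x, u x ∂Q) * ∫⁻ x, v x * k x y ∂Q =
        ∫⁻ z, u z.1 * (v z.2 * k z.2 y) ∂(Q.prod Q) := by
      rw [lintegral_prod_mul (g := fun x => v x * k x y) hu.aemeasurable
        (hv.mul (hk1 y)).aemeasurable]
    calc b * (∫⁻ x, u x * k x y ∂Q - ∫⁻ x, v x * k x y ∂Q)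
        = b * ∫⁻ x, u x * k x y ∂Q - b * ∫⁻ x, v x * k x y ∂Q :=
          ENNReal.mul_sub fun _ _ => hvfin
      _ ≤ b * ∫⁻ x, u x * k x y ∂Q - (∫⁻ x, u x ∂Q) * ∫⁻ x, v x * k x y ∂Q := by gcongr
      _ ≤ ∫⁻ z, (u z.1 * k z.1 y * v z.2 - u z.1 * (v z.2 * k z.2 y)) ∂(Q.prod Q) := by
          rw [e1, e2]
          refine lintegral_sub_le _ _ ?_
          have := hk1 y
          fun_prop
      _ ≤ _ := by
          refine lintegral_mono fun z => ?_
          simp only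
          rw [tsub_le_iff_right]
          calc u z.1 * k z.1 y * v z.2 ≤ u z.1 * v z.2 * (k z.1 y - k z.2 y + k z.2 y) := by
                rw [mul_right_comm]
                gcongr
                exact le_tsub_add
            _ = _ := by ring
  calc ∫⁻ y, b * (∫⁻ x, u x * k x y ∂Q - ∫⁻ x, v x * k x y ∂Q) ∂ν
      ≤ ∫⁻ y, ∫⁻ z, u z.1 * v z.2 * (k z.1 y - k z.2 y) ∂(Q.prod Q) ∂ν := lintegral_mono hpt
    _ = ∫⁻ z, ∫⁻ y, u z.1 * v z.2 * (k z.1 y - k z.2 y) ∂ν ∂(Q.prod Q) :=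
        (lintegral_lintegral_swap hm3.aemeasurable).symm
    _ ≤ ∫⁻ z, u z.1 * v z.2 * ε ∂(Q.prod Q) := by
        refine lintegral_mono_ae ?_
        filter_upwards [hε] with z hz
        have h1 := hk2 z.1
        have h2 := hk2 z.2
        rw [lintegral_const_mul _ (by fun_prop)]
        gcongr
    _ = b * (ε * ∫⁻ x, u x ∂Q) := by
        rw [lintegral_mul_const _ (by fun_prop), lintegral_prod_mul hu.aemeasurable
          hv.aemeasurable]
        ring

/-- Removing the common part `min p q` reduces to the disjoint excesses `p - q` and `q - p`;
applying the previous bound to `p` and `q` themselves would give only `ε * ∫ p`. -/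
lemma lintegral_sub_lintegral_kernel_le (hk : Measurable (Function.uncurry k))
    (hε : ∀ᵐ z ∂(Q.prod Q), ∫⁻ y, (k z.1 y - k z.2 y) ∂ν ≤ ε)
    {p q : α → ℝ≥0∞} (hp : Measurable p) (hq : Measurable q)
    (hpq : ∫⁻ x, p x ∂Q ≤ ∫⁻ x, q x ∂Q) (hqfin : ∫⁻ x, q x ∂Q ≠ ∞) :
    ∫⁻ y, (∫⁻ x, p x * k x y ∂Q - ∫⁻ x, q x * k x y ∂Q) ∂ν ≤ ε * ∫⁻ x, (p x - q x) ∂Q := by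
  have hk1 : ∀ y, Measurable fun x => k x y := fun y => hk.comp measurable_prodMk_right
  have hp' : ∀ x, p x = (p x - q x) + min (p x) (q x) := fun x => (tsub_add_min).symm
  have hq' : ∀ x, q x = (q x - p x) + min (p x) (q x) := fun x => by
    rw [min_comm]; exact (tsub_add_min).symm
  have hmin : Measurable fun x => min (p x) (q x) := hp.min hq
  have hle : ∫⁻ x, (p x - q x) ∂Q ≤ ∫⁻ x, (q x - p x) ∂Q := by
    have hm : ∫⁻ x, min (p x) (q x) ∂Q ≠ ∞ :=
      ne_top_of_le_ne_top hqfin (lintegral_mono fun x => min_le_right _ _)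
    rw [← ENNReal.add_le_add_iff_right hm, ← lintegral_add_right _ hmin,
      ← lintegral_add_right _ hmin]
    simpa only [← hp', ← hq'] using hpq
  refine le_trans (lintegral_mono fun y => ?_)
    (lintegral_sub_lintegral_kernel_le_of_le hk hε (hp.sub hq) (hq.sub hp) hle
      (ne_top_of_le_ne_top hqfin (lintegral_mono fun x => tsub_le_self)))
  have hmk : Measurable fun x => min (p x) (q x) * k x y := hmin.mul (hk1 y)
  have e1 : ∫⁻ x, p x * k x y ∂Q =
      ∫⁻ x, (p x - q x) * k x y ∂Q + ∫⁻ x, min (p x) (q x) * k x y ∂Q := by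
    rw [← lintegral_add_right _ hmk]
    exact lintegral_congr fun x => by rw [← add_mul, ← hp']
  have e2 : ∫⁻ x, q x * k x y ∂Q =
      ∫⁻ x, (q x - p x) * k x y ∂Q + ∫⁻ x, min (p x) (q x) * k x y ∂Q := by
    rw [← lintegral_add_right _ hmk]
    exact lintegral_congr fun x => by rw [← add_mul, ← hq']
  simp only [Pi.sub_apply]
  rw [e1, e2]
  exact add_tsub_add_le_tsub_right

end HockeyStick

/-! ### Dobrushin bound and existence of an admissible `α` -/

lemma conv_withDensity_volume (P : Measure ℝ) [SFinite P] {f : ℝ → ℝ≥0∞} (hf : Measurable f)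
    [SFinite ((volume : Measure ℝ).withDensity f)] :
    P.conv (volume.withDensity f) = volume.withDensity fun y => ∫⁻ x, f (y - x) ∂P := by
  ext s hs
  have hm : Measurable fun z : ℝ × ℝ => s.indicator (fun _ => (1 : ℝ≥0∞)) z.2 * f (z.2 - z.1) :=
    (((measurable_const.indicator hs).comp measurable_snd)).mul (by fun_prop)
  have h1 : Measurable (s.indicator (1 : ℝ → ℝ≥0∞)) := measurable_one.indicator hs
  rw [← lintegral_indicator_one hs, Measure.lintegral_conv h1, withDensity_apply _ hs,
    ← lintegral_indicator hs]
  calc ∫⁻ x, ∫⁻ z, s.indicator 1 (x + z) ∂(volume.withDensity f) ∂P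
      = ∫⁻ x, (∫⁻ y, s.indicator (fun _ => (1 : ℝ≥0∞)) y * f (y - x)) ∂P := by
        refine lintegral_congr fun x => ?_
        rw [lintegral_withDensity_eq_lintegral_mul _ hf (by fun_prop),
          ← lintegral_add_left_eq_self (μ := volume)
            (fun y => s.indicator (fun _ => (1 : ℝ≥0∞)) y * f (y - x)) x]
        refine lintegral_congr fun z => ?_
        simp only [Pi.mul_apply, add_sub_cancel_left]
        rw [mul_comm]
        rfl
    _ = ∫⁻ y, ∫⁻ x, s.indicator (fun _ => (1 : ℝ≥0∞)) y * f (y - x) ∂P :=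
        lintegral_lintegral_swap hm.aemeasurable
    _ = _ := by
        refine lintegral_congr fun y => ?_
        rw [lintegral_const_mul _ (by fun_prop)]
        by_cases hy : y ∈ s <;> simp [hy]

/-- The divergence contracts through an additive-noise channel by the total-variation (Dobrushin)
coefficient. -/
theorem klDiv_conv_le_dobrushin_mul {f : ℝ → ℝ≥0∞} (hf : Measurable f)
    [IsProbabilityMeasure ((volume : Measure ℝ).withDensity f)] (P Q : Measure ℝ)
    [IsProbabilityMeasure P] [IsProbabilityMeasure Q] {ε : ℝ≥0∞}
    (hε : ∀ᵐ z ∂(Q.prod Q), ∫⁻ y, (f (y - z.1) - f (y - z.2)) ≤ ε) (hfin : klDiv P Q ≠ ∞) :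
    klDiv (P.conv (volume.withDensity f)) (Q.conv (volume.withDensity f)) ≤ ε * klDiv P Q := by
  have hac : P ≪ Q := (klDiv_ne_top_iff.1 hfin).1
  set g := P.rnDeriv Q with hg
  have hgm : Measurable g := Measure.measurable_rnDeriv P Q
  have hgP : Q.withDensity g = P := Measure.withDensity_rnDeriv_eq P Q hac
  have hk : Measurable (Function.uncurry fun x y : ℝ => f (y - x)) := by
    unfold Function.uncurry; fun_prop
  set h : ℝ → ℝ≥0∞ := fun y => ∫⁻ x, f (y - x) ∂Q with hh
  set G : ℝ → ℝ≥0∞ := fun y => ∫⁻ x, g x * f (y - x) ∂Q with hG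
  have hhm : Measurable h := Measurable.lintegral_prod_left' (f := fun z : ℝ × ℝ => f (z.2 - z.1))
    (by fun_prop)
  have hGm : Measurable G := Measurable.lintegral_prod_left'
    (f := fun z : ℝ × ℝ => g z.1 * f (z.2 - z.1)) (by fun_prop)
  have hQh : Q.conv (volume.withDensity f) = volume.withDensity h := conv_withDensity_volume Q hf
  have hPG : P.conv (volume.withDensity f) = volume.withDensity G := by
    rw [conv_withDensity_volume P hf]
    congr 1
    ext y
    conv_lhs => rw [← hgP]
    rw [lintegral_withDensity_eq_lintegral_mul _ hgm (by fun_prop)]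
    rfl
  have hprobQ : IsProbabilityMeasure ((volume : Measure ℝ).withDensity h) := by
    rw [← hQh]; infer_instance
  have hprobP : IsProbabilityMeasure ((volume : Measure ℝ).withDensity G) := by
    rw [← hPG]; infer_instance
  have hhfin : ∀ᵐ y, h y < ∞ := ae_lt_top hhm (by
    rw [← setLIntegral_univ, ← withDensity_apply _ MeasurableSet.univ]
    exact measure_ne_top _ _)
  have hh0 : ∀ y, h y = 0 → G y = 0 := by
    intro y hy
    rw [hh, lintegral_eq_zero_iff (by fun_prop)] at hy
    rw [hG, lintegral_eq_zero_iff (by fun_prop)]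
    filter_upwards [hy] with x hx
    simp only [Pi.zero_apply] at hx
    simp [hx]
  have hmul : ∀ᵐ y, h y * (G y / h y) = G y := by
    filter_upwards [hhfin] with y hy
    by_cases h0 : h y = 0
    · simp [h0, hh0 y h0]
    · exact ENNReal.mul_div_cancel h0 hy.ne
  have hdm : Measurable fun y => G y / h y := hGm.div hhm
  have hPG' : (volume : Measure ℝ).withDensity G =
      ((volume : Measure ℝ).withDensity h).withDensity fun y => G y / h y := by
    rw [← withDensity_mul _ hhm hdm]
    refine withDensity_congr_ae ?_
    filter_upwards [hmul] with y hy
    exact hy.symm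
  have : IsFiniteMeasure (((volume : Measure ℝ).withDensity h).withDensity fun y => G y / h y) := by
    rw [← hPG']; infer_instance
  have : IsFiniteMeasure (Q.withDensity g) := by rw [hgP]; infer_instance
  have hg1 : ∫⁻ x, g x ∂Q = 1 := by
    rw [← setLIntegral_univ, ← withDensity_apply _ MeasurableSet.univ, hgP, measure_univ]
  -- Both divergences are now mixtures over the same `s` with the same weight `1 / s`, so it
  -- suffices to compare the integrands for each `s`.
  rw [hPG, hQh, hPG', klDiv_withDensity_eq_lintegral_hockeyStick _ hdm]
  conv_rhs => rw [← hgP, klDiv_withDensity_eq_lintegral_hockeyStick Q hgm]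
  have hmR : Measurable fun s : ℝ => ENNReal.ofReal s⁻¹ *
      (if 1 < s then ∫⁻ x, (g x - ENNReal.ofReal s) ∂Q
        else ∫⁻ x, (ENNReal.ofReal s - g x) ∂Q) := by
    refine Measurable.mul (by fun_prop) (Measurable.ite measurableSet_Ioi ?_ ?_)
    · exact Measurable.lintegral_prod_left' (f := fun z : ℝ × ℝ => g z.1 - ENNReal.ofReal z.2)
        (by fun_prop)
    · exact Measurable.lintegral_prod_left' (f := fun z : ℝ × ℝ => ENNReal.ofReal z.2 - g z.1)
        (by fun_prop)
  rw [← lintegral_const_mul _ hmR]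
  refine lintegral_mono fun s => ?_
  rw [mul_left_comm]
  refine mul_le_mul_right ?_ _
  have hs1 : ∫⁻ _, ENNReal.ofReal s ∂Q = ENNReal.ofReal s := by simp
  have hsh : ∀ y, ∫⁻ x, ENNReal.ofReal s * f (y - x) ∂Q = ENNReal.ofReal s * h y := fun y =>
    lintegral_const_mul _ (by fun_prop)
  split_ifs with hs
  · refine le_trans ?_ (lintegral_sub_lintegral_kernel_le (ν := volume) hk hε hgm
      (measurable_const (a := ENNReal.ofReal s)) ?_ (by rw [hs1]; exact ENNReal.ofReal_ne_top))
    · rw [lintegral_withDensity_eq_lintegral_mul _ hhm (by fun_prop)]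
      refine lintegral_mono_ae ?_
      filter_upwards [hhfin, hmul] with y hy hy'
      simp only [Pi.mul_apply]
      rw [hsh, ENNReal.mul_sub fun _ _ => hy.ne, hy', mul_comm (h y)]
    · rw [hg1, hs1]
      exact ENNReal.one_le_ofReal.2 hs.le
  · refine le_trans ?_ (lintegral_sub_lintegral_kernel_le (ν := volume) hk hε
      (measurable_const (a := ENNReal.ofReal s)) hgm ?_ (by rw [hg1]; exact ENNReal.one_ne_top))
    · rw [lintegral_withDensity_eq_lintegral_mul _ hhm (by fun_prop)]
      refine lintegral_mono_ae ?_
      filter_upwards [hhfin, hmul] with y hy hy'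
      simp only [Pi.mul_apply]
      rw [hsh, ENNReal.mul_sub fun _ _ => hy.ne, hy', mul_comm (h y)]
    · rw [hg1, hs1]
      exact ENNReal.ofReal_le_one.2 (not_lt.1 hs)

/-- Continuity of translations in `L¹`. -/
lemma exists_lintegral_translate_sub_le {f : ℝ → ℝ} (hf : Integrable f) {ε : ℝ} (hε : 0 < ε) :
    ∃ δ > 0, ∀ x ∈ Icc (-δ) δ, ∀ x' ∈ Icc (-δ) δ,
      ∫⁻ y, (ENNReal.ofReal (f (y - x)) - ENNReal.ofReal (f (y - x'))) ≤ ENNReal.ofReal ε := by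
  have hf1 : MemLp f 1 (volume : Measure ℝ) := memLp_one_iff_integrable.2 hf
  have : Fact ((1 : ℝ≥0∞) ≠ ∞) := ⟨ENNReal.one_ne_top⟩
  have hcont : Continuous fun x : ℝ => DomAddAct.mk (-x) +ᵥ hf1.toLp f := by
    have : Continuous fun x : ℝ => DomAddAct.mk (-x) :=
      DomAddAct.continuous_mk.comp continuous_neg
    exact this.vadd continuous_const
  -- Both translates are compared with the untranslated function, whence `ε / 2`.
  obtain ⟨δ, hδ, h⟩ := Metric.continuousAt_iff.1 (hcont.continuousAt (x := 0)) (ε / 2) (by positivity)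
  refine ⟨δ / 2, by positivity, fun x hx x' hx' => ?_⟩
  have hmem : ∀ z ∈ Icc (-(δ / 2)) (δ / 2), dist z 0 < δ := fun z hz => by
    rw [Real.dist_0_eq_abs, abs_lt]
    constructor <;> linarith [hz.1, hz.2]
  have hd : dist (DomAddAct.mk (-x) +ᵥ hf1.toLp f) (DomAddAct.mk (-x') +ᵥ hf1.toLp f) < ε := by
    have := dist_triangle_right (DomAddAct.mk (-x) +ᵥ hf1.toLp f)
      (DomAddAct.mk (-x') +ᵥ hf1.toLp f) (DomAddAct.mk (-0 : ℝ) +ᵥ hf1.toLp f)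
    refine this.trans_lt ((add_lt_add (h (hmem x hx)) (h (hmem x' hx'))).trans_eq ?_)
    ring
  rw [DomAddAct.mk_vadd_toLp, DomAddAct.mk_vadd_toLp] at hd
  rw [← edist_lt_ofReal, Lp.edist_toLp_toLp, eLpNorm_one_eq_lintegral_enorm] at hd
  refine le_trans (lintegral_mono fun y => ?_) hd.le
  simp only [vadd_eq_add, Pi.sub_apply]
  rw [neg_add_eq_sub, neg_add_eq_sub]
  rw [tsub_le_iff_right]
  calc ENNReal.ofReal (f (y - x)) ≤ ENNReal.ofReal (|f (y - x) - f (y - x')| + f (y - x')) :=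
        ENNReal.ofReal_le_ofReal (by linarith [le_abs_self (f (y - x) - f (y - x'))])
    _ ≤ _ := by
        refine ENNReal.ofReal_add_le.trans ?_
        rw [Real.enorm_eq_ofReal_abs]

theorem alphaSet_nonempty (PZ : Measure ℝ) [IsProbabilityMeasure PZ] (hac : PZ ≪ volume) :
    (alphaSet PZ).Nonempty := by
  set f : ℝ → ℝ := fun y => (PZ.rnDeriv volume y).toReal with hf
  have hfm : Measurable f := (Measure.measurable_rnDeriv _ _).ennreal_toReal
  have hfPZ : (volume : Measure ℝ).withDensity (fun y => ENNReal.ofReal (f y)) = PZ := by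
    conv_rhs => rw [← Measure.withDensity_rnDeriv_eq PZ volume hac]
    refine withDensity_congr_ae ?_
    filter_upwards [Measure.rnDeriv_lt_top PZ volume] with y hy
    exact ENNReal.ofReal_toReal hy.ne
  have : IsProbabilityMeasure
      ((volume : Measure ℝ).withDensity (fun y => ENNReal.ofReal (f y))) := by
    rw [hfPZ]; infer_instance
  obtain ⟨δ, hδ, h⟩ := exists_lintegral_translate_sub_le (f := f)
    Measure.integrable_toReal_rnDeriv (ε := 1 / 3) (by norm_num)
  -- Chosen so that the radius `1 / (2α)` is exactly `δ`.
  refine ⟨1 / (2 * δ), by positivity, ?_⟩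
  have hrad : 1 / (2 * (1 / (2 * δ))) = δ := by field_simp
  rw [hrad]
  refine sSup_le ?_
  rintro r ⟨P, Q, iP, iQ, hP, hQ, hPQ, hfin, rfl⟩
  have hd : klDiv P Q ≠ 0 := fun h0 => hPQ (klDiv_eq_zero_iff.1 h0)
  rw [ENNReal.div_le_iff hd hfin]
  have hQae : ∀ᵐ x ∂Q, x ∈ Icc (-δ) δ := (prob_compl_eq_zero_iff measurableSet_Icc).2 hQ
  have key := klDiv_conv_le_dobrushin_mul (f := fun y => ENNReal.ofReal (f y)) (by fun_prop) P Q
    (ε := 1 / 3) ?_ hfin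
  · rwa [hfPZ] at key
  · have h1 : ∀ᵐ z ∂(Q.prod Q), z.1 ∈ Icc (-δ) δ :=
      Measure.quasiMeasurePreserving_fst.ae hQae
    have h2 : ∀ᵐ z ∂(Q.prod Q), z.2 ∈ Icc (-δ) δ :=
      Measure.quasiMeasurePreserving_snd.ae hQae
    filter_upwards [h1, h2] with z hz1 hz2
    refine (h z.1 hz1 z.2 hz2).trans ?_
    rw [ENNReal.ofReal_div_of_pos (by norm_num)]
    simp

/-! ### The Markov chain as a composition of kernels -/

section Markov

variable {Ω 𝒲 : Type*} [MeasurableSpace Ω] [MeasurableSpace 𝒲] {μ : Measure Ω}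
  [IsProbabilityMeasure μ] {W : Ω → 𝒲} {X Z Y : Ω → ℝ}

lemma map_pair_eq_compProd_addNoise (hX : Measurable X) (hZ : Measurable Z)
    (hY : ∀ ω, Y ω = X ω + Z ω) (hXZ : IndepFun X Z μ) :
    μ.map (fun ω => (X ω, Y ω)) = μ.map X ⊗ₘ addNoise (μ.map Z) := by
  have : IsProbabilityMeasure (μ.map Z) := Measure.isProbabilityMeasure_map hZ.aemeasurable
  have hm : Measurable fun q : ℝ × ℝ => (q.1, q.1 + q.2) := by fun_prop
  have h1 : (fun ω => (X ω, Y ω)) = (fun q : ℝ × ℝ => (q.1, q.1 + q.2)) ∘ fun ω => (X ω, Z ω) := by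
    ext ω <;> simp [hY]
  rw [h1, ← Measure.map_map hm (hX.prodMk hZ),
    hXZ.map_prod_eq_prod_map_map hX.aemeasurable hZ.aemeasurable]
  ext s hs
  rw [Measure.map_apply hm hs, Measure.prod_apply (hm hs), Measure.compProd_apply hs]
  refine lintegral_congr fun x => ?_
  rw [addNoise_apply, Measure.map_apply (by fun_prop) (measurable_prodMk_left hs)]
  rfl

/-- Under the Markov chain `W → X → X + Z`, the joint law of `(W, X + Z)` is obtained by passing
the conditional law of `X` given `W` through the channel. -/
theorem IsMarkovChain.map_pair_eq (hW : Measurable W) (hX : Measurable X) (hZ : Measurable Z)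
    (hY : ∀ ω, Y ω = X ω + Z ω) (hXZ : IndepFun X Z μ) (h : IsMarkovChain W X Y μ) :
    μ.map (fun ω => (W ω, Y ω)) =
      μ.map W ⊗ₘ (addNoise (μ.map Z) ∘ₖ condDistrib X W μ) := by
  have : IsProbabilityMeasure (μ.map Z) := Measure.isProbabilityMeasure_map hZ.aemeasurable
  have hYm : Measurable Y := by
    have : Y = fun ω => X ω + Z ω := funext hY
    rw [this]; exact hX.add hZ
  set N := addNoise (μ.map Z) with hN
  refine Measure.ext_prod fun {S T} hS hT => ?_
  -- Since `X` and `Z` are independent, the conditional law of `Y` given `X` is the channel `N`.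
  have hcY : (fun ω => (N (X ω)).real T) =ᵐ[μ]
      μ[(Y ⁻¹' T).indicator (fun _ => (1 : ℝ)) | MeasurableSpace.comap X inferInstance] := by
    have h1 := condDistrib_ae_eq_of_measure_eq_compProd X hYm.aemeasurable
      (map_pair_eq_compProd_addNoise hX hZ hY hXZ)
    filter_upwards [ae_of_ae_map hX.aemeasurable h1,
      condDistrib_ae_eq_condExp (μ := μ) hX hYm hT] with ω h1 h2
    rw [← h2, h1]
  have hNm : Measurable fun x => (N x).real T := (Kernel.measurable_coe N hT).ennreal_toReal
  have hle : MeasurableSpace.comap X inferInstance ≤ (inferInstance : MeasurableSpace Ω) :=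
    hX.comap_le
  set f : Ω → ℝ := (W ⁻¹' S).indicator fun _ => (1 : ℝ) with hf
  set g : Ω → ℝ := fun ω => (N (X ω)).real T with hg
  have hfi : Integrable f μ := (integrable_const 1).indicator (hW hS)
  have hgs : StronglyMeasurable[MeasurableSpace.comap X inferInstance] g :=
    (hNm.comp (Measurable.of_comap_le le_rfl)).stronglyMeasurable
  have hfg : Integrable (f * g) μ := by
    refine hfi.mul_bdd (c := 1) (hNm.comp hX).aestronglyMeasurable (ae_of_all _ fun ω => ?_)
    rw [Real.norm_of_nonneg measureReal_nonneg]
    exact measureReal_le_one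
  -- Conditional independence factors the conditional probability; the factor `g` is a function of
  -- `X` and is pulled back inside the conditional expectation.
  have hreal : μ.real (W ⁻¹' S ∩ Y ⁻¹' T) = ∫ ω, (f * g) ω ∂μ := by
    calc μ.real (W ⁻¹' S ∩ Y ⁻¹' T)
        = ∫ ω, (W ⁻¹' S ∩ Y ⁻¹' T).indicator (fun _ => (1 : ℝ)) ω ∂μ := by
          rw [integral_indicator ((hW hS).inter (hYm hT))]
          simp
      _ = ∫ ω, (μ[(W ⁻¹' S ∩ Y ⁻¹' T).indicator (fun _ => (1 : ℝ)) |
            MeasurableSpace.comap X inferInstance]) ω ∂μ := (integral_condExp hle).symm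
      _ = ∫ ω, (μ[f * g | MeasurableSpace.comap X inferInstance]) ω ∂μ := by
          refine integral_congr_ae ?_
          filter_upwards [h S T hS hT, hcY,
            condExp_mul_of_stronglyMeasurable_right hgs hfg hfi] with ω h1 h2 h3
          rw [h1, h3, Pi.mul_apply, Pi.mul_apply, ← h2]
      _ = _ := integral_condExp hle
  have hlin : μ (W ⁻¹' S ∩ Y ⁻¹' T) = ∫⁻ ω in W ⁻¹' S, N (X ω) T ∂μ := by
    rw [← ofReal_measureReal, hreal, ofReal_integral_eq_lintegral_ofReal hfg
      (ae_of_all _ fun ω => mul_nonneg (indicator_nonneg (fun _ _ => zero_le_one) ω)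
        measureReal_nonneg), ← lintegral_indicator (hW hS)]
    refine lintegral_congr fun ω => ?_
    by_cases hω : ω ∈ W ⁻¹' S <;> simp [hf, hg, hω]
  have hmN : Measurable fun q : 𝒲 × ℝ => N q.2 T := (Kernel.measurable_coe N hT).comp measurable_snd
  rw [Measure.map_apply (hW.prodMk hYm) (hS.prod hT), Measure.compProd_apply_prod hS hT]
  calc μ ((fun ω => (W ω, Y ω)) ⁻¹' S ×ˢ T) = ∫⁻ ω in W ⁻¹' S, N (X ω) T ∂μ := hlin
    _ = ∫⁻ q in S ×ˢ univ, N q.2 T ∂(μ.map fun ω => (W ω, X ω)) := by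
        rw [setLIntegral_map (hS.prod MeasurableSet.univ) hmN (hW.prodMk hX)]
        congr 2
        ext ω
        simp
    _ = ∫⁻ w in S, ∫⁻ x, N x T ∂(condDistrib X W μ w) ∂(μ.map W) := by
        rw [← compProd_map_condDistrib hX.aemeasurable,
          Measure.setLIntegral_compProd hmN hS MeasurableSet.univ]
        simp
    _ = _ := by
        refine lintegral_congr fun w => ?_
        rw [Kernel.comp_apply' _ _ _ hT]

/-- Written as an average over `w`, mutual information inherits any divergence bound for a fixed
pair of input laws, here the law of `X` given `W = w` and the law of `X`. -/
lemma mutualInfo_eq_lintegral (hW : Measurable W) (hX : Measurable X) :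
    mutualInfo W X μ = ∫⁻ w, klDiv (condDistrib X W μ w) (μ.map X) ∂(μ.map W) := by
  have := Measure.isProbabilityMeasure_map (μ := μ) hX.aemeasurable
  have := Measure.isProbabilityMeasure_map (μ := μ) hW.aemeasurable
  rw [mutualInfo, ← Measure.compProd_const, ← compProd_map_condDistrib hX.aemeasurable,
    klDiv_compProd_right]
  rfl

lemma IsMarkovChain.mutualInfo_eq_lintegral_conv (hW : Measurable W) (hX : Measurable X)
    (hZ : Measurable Z) (hY : ∀ ω, Y ω = X ω + Z ω) (hXZ : IndepFun X Z μ)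
    (h : IsMarkovChain W X Y μ) :
    mutualInfo W Y μ = ∫⁻ w, klDiv ((condDistrib X W μ w).conv (μ.map Z))
      ((μ.map X).conv (μ.map Z)) ∂(μ.map W) := by
  have hYf : Y = X + Z := funext hY
  have := Measure.isProbabilityMeasure_map (μ := μ) hZ.aemeasurable
  have := Measure.isProbabilityMeasure_map (μ := μ) hX.aemeasurable
  have := Measure.isProbabilityMeasure_map (μ := μ) hW.aemeasurable
  have hYl : μ.map Y = (μ.map X).conv (μ.map Z) := by
    rw [hYf]
    exact hXZ.map_add_eq_map_conv_map hX hZ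
  rw [mutualInfo, h.map_pair_eq hW hX hZ hY hXZ, hYl, ← Measure.compProd_const,
    klDiv_compProd_right]
  simp_rw [addNoise_comp_apply]
  rfl

/-- Data processing for the Markov chain `W → X → X + Z`. -/
lemma IsMarkovChain.mutualInfo_le (hW : Measurable W) (hX : Measurable X)
    (hZ : Measurable Z) (hY : ∀ ω, Y ω = X ω + Z ω) (hXZ : IndepFun X Z μ)
    (h : IsMarkovChain W X Y μ) : mutualInfo W Y μ ≤ mutualInfo W X μ := by
  have := Measure.isProbabilityMeasure_map (μ := μ) hZ.aemeasurable
  have := Measure.isProbabilityMeasure_map (μ := μ) hX.aemeasurable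
  rw [h.mutualInfo_eq_lintegral_conv hW hX hZ hY hXZ, mutualInfo_eq_lintegral hW hX]
  exact lintegral_mono fun w => klDiv_conv_le _ _ _

end Markov

/-! ### Information is bounded by entropy -/

section Entropy

variable {α ι : Type*} [MeasurableSpace α] [MeasurableSpace ι] [Countable ι]
  [MeasurableSingletonClass ι]

/-- With `p = r q`, the left side is `p log r + q`, and `log r ≤ -log q` because `p ≤ 1`. The linear
terms stand on opposite sides to avoid subtraction in `ℝ≥0∞`. -/
lemma klDiv_mul_add_le (p q : ℝ≥0∞) (r : ℝ≥0∞) (hq : q ≤ 1) (hp : p ≤ 1) (hr : r * q = p) :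
    ENNReal.ofReal (klFun r.toReal) * q + p ≤ ENNReal.ofReal (-Real.log q.toReal) * p + q := by
  rcases eq_or_ne q 0 with rfl | hq0
  · have : p = 0 := by rw [← hr, mul_zero]
    simp [this]
  have hqt : q ≠ ∞ := ne_top_of_le_ne_top ENNReal.one_ne_top hq
  have hpt : p ≠ ∞ := ne_top_of_le_ne_top ENNReal.one_ne_top hp
  have hrt : r ≠ ∞ := by
    rintro rfl
    rw [ENNReal.top_mul hq0] at hr
    exact hpt hr.symm
  have hq' : 0 < q.toReal := ENNReal.toReal_pos hq0 hqt
  have hq1 : q.toReal ≤ 1 := ENNReal.toReal_le_of_le_ofReal zero_le_one (by simpa using hq)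
  have hp1 : p.toReal ≤ 1 := ENNReal.toReal_le_of_le_ofReal zero_le_one (by simpa using hp)
  have hpr : p.toReal = r.toReal * q.toReal := by rw [← hr, ENNReal.toReal_mul]
  have hr0 : 0 ≤ r.toReal := ENNReal.toReal_nonneg
  have hlog : 0 ≤ -Real.log q.toReal := neg_nonneg.2 (Real.log_nonpos hq'.le hq1)
  rw [← ENNReal.ofReal_toReal hqt, ← ENNReal.ofReal_toReal hpt,
    ENNReal.toReal_ofReal hq'.le, ← ENNReal.ofReal_mul (klFun_nonneg hr0),
    ← ENNReal.ofReal_mul hlog, ← ENNReal.ofReal_add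
      (mul_nonneg (klFun_nonneg hr0) hq'.le) ENNReal.toReal_nonneg,
    ← ENNReal.ofReal_add (mul_nonneg hlog ENNReal.toReal_nonneg) hq'.le]
  refine ENNReal.ofReal_le_ofReal ?_
  rw [klFun_apply, hpr]
  rcases hr0.eq_or_lt with h0 | h0
  · rw [← h0]; simp
  have h1 : Real.log r.toReal + Real.log q.toReal ≤ 0 := by
    rw [← Real.log_mul h0.ne' hq'.ne', ← hpr]
    exact Real.log_nonpos ENNReal.toReal_nonneg hp1
  nlinarith [mul_nonneg (mul_pos h0 hq').le (neg_nonneg.2 h1)]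

/-- The information that a discrete variable carries is at most its entropy. -/
lemma lintegral_klDiv_comp_le_entropy (ν : Measure α) [IsProbabilityMeasure ν] (κ : Kernel α ι)
    [IsMarkovKernel κ] (Q : Measure ι) [IsProbabilityMeasure Q] (hQ : κ ∘ₘ ν = Q)
    (hac : ∀ᵐ a ∂ν, κ a ≪ Q) :
    ∫⁻ a, klDiv (κ a) Q ∂ν ≤ ∑' i, ENNReal.ofReal (Real.negMulLog (Q.real {i})) := by
  have hterm : ∀ i, Measurable fun a => ENNReal.ofReal
      (klFun ((κ.rnDeriv (Kernel.const α Q) a i).toReal)) * Q {i} := by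
    intro i
    exact ((measurable_klFun.comp
      (((Kernel.measurable_rnDeriv κ (Kernel.const α Q)).comp
        measurable_prodMk_right).ennreal_toReal)).ennreal_ofReal).mul_const _
  have h1 : ∫⁻ a, klDiv (κ a) Q ∂ν = ∑' i, ∫⁻ a, ENNReal.ofReal
      (klFun ((κ.rnDeriv (Kernel.const α Q) a i).toReal)) * Q {i} ∂ν := by
    rw [← lintegral_tsum fun i => (hterm i).aemeasurable]
    refine lintegral_congr_ae ?_
    filter_upwards [hac] with a ha
    have := klDiv_kernel_of_ac κ (Kernel.const α Q) (a := a) ha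
    rw [Kernel.const_apply] at this
    rw [this, lintegral_countable']
  rw [h1]
  refine ENNReal.tsum_le_tsum fun i => ?_
  have hi : MeasurableSet {i} := measurableSet_singleton i
  have hmean : ∫⁻ a, κ a {i} ∂ν = Q {i} := by
    rw [← hQ, Measure.bind_apply hi (Kernel.aemeasurable _)]
  have hκ : Measurable fun a => κ a {i} := Kernel.measurable_coe κ hi
  -- The average of `κ a {i}` is `Q {i}`, so adding `Q {i}` supplies the linear terms of
  -- `klDiv_mul_add_le`, which cancel after averaging.
  rw [← ENNReal.add_le_add_iff_right (measure_ne_top Q {i})]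
  calc ∫⁻ a, ENNReal.ofReal (klFun ((κ.rnDeriv (Kernel.const α Q) a i).toReal)) * Q {i} ∂ν + Q {i}
      = ∫⁻ a, (ENNReal.ofReal (klFun ((κ.rnDeriv (Kernel.const α Q) a i).toReal)) * Q {i} +
          κ a {i}) ∂ν := by
        rw [lintegral_add_right _ hκ, hmean]
    _ ≤ ∫⁻ a, (ENNReal.ofReal (-Real.log (Q.real {i})) * κ a {i} + Q {i}) ∂ν := by
        refine lintegral_mono_ae ?_
        filter_upwards [hac] with a ha
        refine klDiv_mul_add_le _ _ _ prob_le_one prob_le_one ?_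
        have := Kernel.setLIntegral_rnDeriv (κ := κ) (η := Kernel.const α Q) (a := a) ha hi
        rwa [lintegral_singleton, Kernel.const_apply] at this
    _ = ENNReal.ofReal (Real.negMulLog (Q.real {i})) + Q {i} := by
        rw [lintegral_add_right _ measurable_const, lintegral_const_mul _ hκ, hmean]
        simp only [lintegral_const, measure_univ, mul_one]
        congr 1
        rw [Real.negMulLog, neg_mul_comm, ENNReal.ofReal_mul measureReal_nonneg, mul_comm,
          ofReal_measureReal]

end Entropy

/-! ### Mutual information along a partition -/

section Partition

variable {Ω 𝒲 : Type*} [MeasurableSpace Ω] [MeasurableSpace 𝒲] {μ : Measure Ω}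
  [IsProbabilityMeasure μ] {W : Ω → 𝒲} {X Z Y : Ω → ℝ}

/-- Averaging the divergence bound over `w` leaves `I(W; B(X))` as the coarse term, which the
entropy of `B(X)` dominates. -/
theorem IsMarkovChain.mutualInfo_le_of_partition (hW : Measurable W) (hX : Measurable X)
    (hZ : Measurable Z) (hY : ∀ ω, Y ω = X ω + Z ω) (hXZ : IndepFun X Z μ)
    (h : IsMarkovChain W X Y μ) {B : ℝ → ℤ} (hB : Measurable B) {e : ℝ≥0∞} (he : e ≤ 1)
    (hcell : ∀ b, ∀ P' Q' : Measure ℝ, IsProbabilityMeasure P' → IsProbabilityMeasure Q' →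
      P' (B ⁻¹' {b}) = 1 → Q' (B ⁻¹' {b}) = 1 → klDiv P' Q' ≠ ∞ →
      klDiv (P'.conv (μ.map Z)) (Q'.conv (μ.map Z)) ≤ e * klDiv P' Q')
    (hfin : mutualInfo W X μ ≠ ∞) :
    mutualInfo W Y μ ≤ e * mutualInfo W X μ +
      (1 - e) * ∑' b, ENNReal.ofReal (Real.negMulLog ((μ.map X).real (B ⁻¹' {b}))) := by
  have := Measure.isProbabilityMeasure_map (μ := μ) hZ.aemeasurable
  have := Measure.isProbabilityMeasure_map (μ := μ) hX.aemeasurable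
  have := Measure.isProbabilityMeasure_map (μ := μ) hW.aemeasurable
  have := Measure.isProbabilityMeasure_map (μ := μ.map X) hB.aemeasurable
  set κ := condDistrib X W μ with hκ
  have hκm : Measurable fun w => klDiv (κ w) (μ.map X) :=
    measurable_klDiv_kernel κ (Kernel.const 𝒲 (μ.map X))
  have hae : ∀ᵐ w ∂(μ.map W), klDiv (κ w) (μ.map X) < ∞ := by
    refine ae_lt_top hκm ?_
    rwa [← mutualInfo_eq_lintegral hW hX]
  have hBκ : ∀ w, (κ.map B) w = (κ w).map B := fun w => Kernel.map_apply κ hB w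
  have hBm : Measurable fun w => klDiv ((κ.map B) w) ((μ.map X).map B) :=
    measurable_klDiv_kernel (κ.map B) (Kernel.const 𝒲 ((μ.map X).map B))
  have hmk : IsMarkovKernel (κ.map B) := Kernel.IsMarkovKernel.map _ hB
  have hent := lintegral_klDiv_comp_le_entropy (μ.map W) (κ.map B) ((μ.map X).map B) ?_ ?_
  · rw [h.mutualInfo_eq_lintegral_conv hW hX hZ hY hXZ]
    calc ∫⁻ w, klDiv ((κ w).conv (μ.map Z)) ((μ.map X).conv (μ.map Z)) ∂(μ.map W)
        ≤ ∫⁻ w, (e * klDiv (κ w) (μ.map X) +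
            (1 - e) * klDiv ((κ.map B) w) ((μ.map X).map B)) ∂(μ.map W) := by
          refine lintegral_mono_ae ?_
          filter_upwards [hae] with w hw
          rw [hBκ]
          exact klDiv_conv_le_of_partition _ _ _ hB he hcell hw.ne
      _ = e * mutualInfo W X μ +
            (1 - e) * ∫⁻ w, klDiv ((κ.map B) w) ((μ.map X).map B) ∂(μ.map W) := by
          rw [lintegral_add_left (hκm.const_mul e), lintegral_const_mul _ hκm,
            lintegral_const_mul _ hBm, mutualInfo_eq_lintegral hW hX]
      _ ≤ _ := by
          gcongr
          refine hent.trans (le_of_eq (tsum_congr fun b => ?_))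
          rw [map_measureReal_apply hB (measurableSet_singleton b)]
  · rw [← Measure.map_comp _ _ hB, condDistrib_comp_map hW.aemeasurable hX.aemeasurable]
  · filter_upwards [hae] with w hw
    rw [hBκ]
    exact (klDiv_ne_top_iff.1 hw.ne).1.map hB

end Partition

/-! ### The cells and the entropy of their index -/

section TailEntropy

/-- Partition of the line into `[-A, A]` (index `0`) and cells of length `1 / α` outside of it. -/
noncomputable def tailCell (α A x : ℝ) : ℤ :=
  if A < x then ⌊α * (x - A)⌋ + 1 else if x < -A then -(⌊α * (-x - A)⌋ + 1) else 0

lemma measurable_tailCell (α A : ℝ) : Measurable (tailCell α A) := by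
  unfold tailCell
  refine Measurable.ite measurableSet_Ioi ?_ (Measurable.ite measurableSet_Iio ?_ measurable_const)
  · exact (Int.measurable_floor.comp (by fun_prop)).add_const 1
  · exact ((Int.measurable_floor.comp (by fun_prop)).add_const 1).neg

/-- Cell `±(k + 1)` begins at distance `A + k / α` from the origin, hence the shift by one. This
turns growth of the index into growth of `|x|`. -/
lemma tailCell_bounds {α A x : ℝ} (hα : 0 < α) (h0 : tailCell α A x ≠ 0) :
    A < |x| ∧ 1 ≤ |tailCell α A x| ∧ α * A + (|tailCell α A x| - 1 : ℤ) ≤ α * |x| := by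
  unfold tailCell at h0 ⊢
  split_ifs at h0 ⊢ with h1 h2
  · have hf : 0 ≤ ⌊α * (x - A)⌋ := Int.floor_nonneg.2 (mul_nonneg hα.le (by linarith))
    rw [abs_of_pos (show 0 < ⌊α * (x - A)⌋ + 1 by omega)]
    refine ⟨h1.trans_le (le_abs_self x), by omega, ?_⟩
    have := Int.floor_le (α * (x - A))
    have := mul_le_mul_of_nonneg_left (le_abs_self x) hα.le
    push_cast
    linarith
  · have hf : 0 ≤ ⌊α * (-x - A)⌋ := Int.floor_nonneg.2 (mul_nonneg hα.le (by linarith))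
    rw [abs_neg, abs_of_pos (show 0 < ⌊α * (-x - A)⌋ + 1 by omega)]
    have hx := neg_le_abs x
    refine ⟨by linarith, by omega, ?_⟩
    have := Int.floor_le (α * (-x - A))
    have := mul_le_mul_of_nonneg_left hx hα.le
    push_cast
    linarith
  · exact absurd rfl h0

lemma tailCell_preimage_zero {α A : ℝ} (hα : 0 < α) :
    tailCell α A ⁻¹' {0} ⊆ Icc (0 - A) (0 + A) := by
  intro x hx
  by_contra hc
  rw [mem_Icc, not_and_or, not_le, not_le] at hc
  simp only [tailCell, mem_preimage, mem_singleton_iff] at hx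
  split_ifs at hx with h1 h2
  · have hf : 0 ≤ ⌊α * (x - A)⌋ := Int.floor_nonneg.2 (mul_nonneg hα.le (by linarith))
    omega
  · have hf : 0 ≤ ⌊α * (-x - A)⌋ := Int.floor_nonneg.2 (mul_nonneg hα.le (by linarith))
    omega
  · rcases hc with hc | hc
    · exact h2 (by linarith)
    · exact h1 (by linarith)

/-- The witness is the midpoint of the cell, at distance `A + (|b| - 1/2) / α` from the origin. -/
lemma exists_tailCell_preimage_subset {α A : ℝ} (hα : 0 < α) {b : ℤ} (hb : b ≠ 0) :
    ∃ c, tailCell α A ⁻¹' {b} ⊆ Icc (c - 1 / (2 * α)) (c + 1 / (2 * α)) := by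
  have hmul : α * (1 / (2 * α)) = 1 / 2 := by field_simp
  rcases lt_or_gt_of_ne hb with hb | hb
  · refine ⟨-(A + (-b - 1 / 2) / α), fun x hx => ?_⟩
    have hdiv : α * ((-b - 1 / 2) / α) = -b - 1 / 2 := by field_simp
    simp only [tailCell, mem_preimage, mem_singleton_iff] at hx
    split_ifs at hx with h1 h2
    · have hf : 0 ≤ ⌊α * (x - A)⌋ := Int.floor_nonneg.2 (mul_nonneg hα.le (by linarith))
      omega
    · have hf : ⌊α * (-x - A)⌋ = -b - 1 := by omega
      rw [Int.floor_eq_iff] at hf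
      push_cast at hf
      constructor <;> refine le_of_mul_le_mul_left ?_ hα <;> nlinarith [hf.1, hf.2]
    · omega
  · refine ⟨A + (b - 1 / 2) / α, fun x hx => ?_⟩
    have hdiv : α * ((b - 1 / 2) / α) = b - 1 / 2 := by field_simp
    simp only [tailCell, mem_preimage, mem_singleton_iff] at hx
    split_ifs at hx with h1 h2
    · have hf : ⌊α * (x - A)⌋ = b - 1 := by omega
      rw [Int.floor_eq_iff] at hf
      push_cast at hf
      constructor <;> refine le_of_mul_le_mul_left ?_ hα <;> nlinarith [hf.1, hf.2]
    · have hf : 0 ≤ ⌊α * (-x - A)⌋ := Int.floor_nonneg.2 (mul_nonneg hα.le (by linarith))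
      omega
    · omega

/-- The term `k = 0` is `1 / m`; the others are dominated by the telescoping differences `m / (m + k
- 1) - m / (m + k)`, which sum to at most `1`. -/
lemma tsum_ofReal_div_sq_le {m : ℝ} (hm : 0 < m) :
    ∑' k : ℕ, ENNReal.ofReal (m / (m + k) ^ 2) ≤ ENNReal.ofReal (1 / m + 1) := by
  have key : ∀ n : ℕ, ∑ k ∈ Finset.range (n + 1), m / (m + k) ^ 2 ≤ 1 / m + 1 - m / (m + n) := by
    intro n
    induction n with
    | zero =>
      simp only [zero_add, Finset.range_one, Finset.sum_singleton, Nat.cast_zero, add_zero]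
      rw [div_self hm.ne']
      apply le_of_eq
      field_simp
      ring
    | succ n ih =>
      rw [Finset.sum_range_succ]
      have hn : (0 : ℝ) < m + n := by positivity
      have h1 : m / (m + (n + 1 : ℕ)) ^ 2 ≤ m / (m + n) - m / (m + (n + 1 : ℕ)) := by
        push_cast
        rw [div_sub_div _ _ hn.ne' (by positivity), div_le_div_iff₀ (by positivity) (by positivity)]
        have : m * (m + (n + 1)) - (m + n) * m = m := by ring
        rw [this]
        have h2 : (m + n) * (m + (n + 1)) ≤ (m + (n + 1)) ^ 2 := by nlinarith
        nlinarith
      linarith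
  refine ENNReal.tsum_le_of_sum_range_le fun n => ?_
  rw [← ENNReal.ofReal_sum_of_nonneg fun k _ => by positivity]
  refine ENNReal.ofReal_le_ofReal ?_
  calc ∑ k ∈ Finset.range n, m / (m + k) ^ 2 ≤ ∑ k ∈ Finset.range (n + 1), m / (m + k) ^ 2 := by
        rw [Finset.sum_range_succ]
        have : (0 : ℝ) ≤ m / (m + n) ^ 2 := by positivity
        linarith
    _ ≤ _ := by
        have : (0 : ℝ) ≤ m / (m + n) := by positivity
        linarith [key n]

/-- With `L = log (A ^ p)` and `s = (y / A) ^ p`, the logarithm is at most `3 L + 2 log s`, since `p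
≥ 1`. As `log s ≤ 3/8 s`, `s ≥ 1` and `L ≥ 1`, this is at most `(3 + 3/4) L s`. -/
lemma log_mul_sq_div_le {p A a y : ℝ} (hp : 1 ≤ p) (hA : 0 < A) (ha : 0 < a) (haA : a ≤ A ^ p)
    (he : Real.exp 1 ≤ A ^ p) (hy : A ≤ y) :
    Real.log (a * A ^ p * y ^ 2 / A) ≤ 15 / 4 * (Real.log (A ^ p) / A ^ p) * y ^ p := by
  have hy0 : 0 < y := hA.trans_le hy
  have hAp : 0 < A ^ p := Real.rpow_pos_of_pos hA p
  have hyp : 0 < y ^ p := Real.rpow_pos_of_pos hy0 p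
  have hp0 : 0 < p := by linarith
  set L := Real.log (A ^ p) with hL
  have hL1 : 1 ≤ L := (Real.le_log_iff_exp_le hAp).2 he
  have hLA : L = p * Real.log A := Real.log_rpow hA p
  set s := y ^ p / A ^ p with hs
  have hs1 : 1 ≤ s := (one_le_div hAp).2 (Real.rpow_le_rpow hA.le hy hp0.le)
  have hs0 : 0 < s := by linarith
  have hlogs : Real.log s = p * Real.log y - L := by
    rw [hs, Real.log_div hyp.ne' hAp.ne', Real.log_rpow hy0]
  have hlogs0 : 0 ≤ Real.log s := Real.log_nonneg hs1
  -- Tangent line of `log` at `8/3`, together with `8/3 < e`.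
  have hlog38 : Real.log s ≤ 3 / 8 * s := by
    have h1 := Real.log_le_sub_one_of_pos (show (0 : ℝ) < 3 / 8 * s by positivity)
    rw [Real.log_mul (by norm_num) hs0.ne'] at h1
    have h2 : Real.log (8 / 3) ≤ 1 := by
      rw [Real.log_le_iff_le_exp (by norm_num)]
      linarith [Real.exp_one_gt_d9]
    have h3 : Real.log (3 / 8) = -Real.log (8 / 3) := by
      rw [← Real.log_inv]; norm_num
    linarith
  have hexp : Real.log (a * A ^ p * y ^ 2 / A) =
      Real.log a + L + 2 * Real.log y - Real.log A := by
    rw [Real.log_div (by positivity) hA.ne', Real.log_mul (by positivity) (by positivity),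
      Real.log_mul ha.ne' hAp.ne', Real.log_pow]
    push_cast
    ring
  have hla : Real.log a ≤ L := Real.log_le_log ha haA
  have hdiff : 2 * Real.log y - Real.log A ≤ 2 * Real.log s + L := by
    have h1 : p * (2 * Real.log y - Real.log A) = 2 * Real.log s + L := by
      rw [hlogs, hLA]; ring
    by_cases hneg : 2 * Real.log y - Real.log A ≤ 0
    · linarith
    · nlinarith
  have hrhs : 15 / 4 * (L / A ^ p) * y ^ p = 15 / 4 * L * s := by rw [hs]; ring
  rw [hexp, hrhs]
  nlinarith [mul_nonneg (sub_nonneg.2 hL1) hs0.le, mul_nonneg (sub_nonneg.2 hs1) (by linarith : 0 ≤ L)]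

end TailEntropy

section TailEntropy

/-- Gibbs' inequality for one atom, from `log (r / π) ≤ r / π - 1`. Keeping the linear terms means
that the reference weights `r` need not sum to one. -/
lemma ofReal_negMulLog_add_le {π : ℝ≥0∞} (hπ : π ≤ 1) {r : ℝ} (hr : 0 < r) :
    ENNReal.ofReal (Real.negMulLog π.toReal) + π ≤
      ENNReal.ofReal (Real.log (1 / r)) * π + ENNReal.ofReal r := by
  have hπt : π ≠ ∞ := ne_top_of_le_ne_top ENNReal.one_ne_top hπ
  have h0 : 0 ≤ π.toReal := ENNReal.toReal_nonneg
  have h1 : π.toReal ≤ 1 := ENNReal.toReal_le_of_le_ofReal zero_le_one (by simpa using hπ)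
  have key : Real.negMulLog π.toReal + π.toReal ≤ Real.log (1 / r) * π.toReal + r := by
    rcases h0.eq_or_lt with h | h
    · rw [← h]; simp [hr.le]
    · have := Real.log_le_sub_one_of_pos (div_pos hr h)
      rw [Real.log_div hr.ne' h.ne'] at this
      have h2 := mul_le_mul_of_nonneg_left this h.le
      have h3 : π.toReal * (r / π.toReal - 1) = r - π.toReal := by field_simp
      rw [h3] at h2
      rw [Real.negMulLog, one_div, Real.log_inv]
      linarith
  calc ENNReal.ofReal (Real.negMulLog π.toReal) + π
      = ENNReal.ofReal (Real.negMulLog π.toReal + π.toReal) := by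
        rw [ENNReal.ofReal_add (Real.negMulLog_nonneg h0 h1) h0, ENNReal.ofReal_toReal hπt]
    _ ≤ ENNReal.ofReal (Real.log (1 / r) * π.toReal + r) := ENNReal.ofReal_le_ofReal key
    _ ≤ ENNReal.ofReal (Real.log (1 / r) * π.toReal) + ENNReal.ofReal r := ENNReal.ofReal_add_le
    _ = _ := by rw [ENNReal.ofReal_mul' h0, ENNReal.ofReal_toReal hπt]

lemma tsum_int_eq_two_mul {f : ℕ → ℝ≥0∞} :
    ∑' b : ℤ, (if b = 0 then 0 else f (b.natAbs - 1)) = 2 * ∑' k, f k := by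
  rw [tsum_of_nat_of_neg_add_one ENNReal.summable ENNReal.summable,
    tsum_eq_zero_add' ENNReal.summable, two_mul]
  have h1 : ∀ k : ℕ, (if ((k + 1 : ℕ) : ℤ) = 0 then 0 else f (((k + 1 : ℕ) : ℤ).natAbs - 1)) =
      f k := fun k => by
    rw [if_neg (by omega)]; rfl
  have h2 : ∀ k : ℕ, (if -((k : ℤ) + 1) = 0 then 0 else f ((-((k : ℤ) + 1)).natAbs - 1)) =
      f k := fun k => by
    rw [if_neg (by omega)]
    congr 1
  simp only [h1, h2]
  simp

lemma tsum_int_eq_add_ite (f : ℤ → ℝ≥0∞) :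
    ∑' b, f b = f 0 + ∑' b, if b = 0 then 0 else f b := by
  convert ENNReal.tsum_eq_add_tsum_ite (f := f) 0

/-- Entropy of the cell index of a variable with bounded `p`-th moment. -/
lemma entropy_tailCell_le (P : Measure ℝ) [IsProbabilityMeasure P] {p γ A a α : ℝ} (hp : 1 ≤ p)
    (hγ : 0 < γ) (hmom : ∫⁻ x, ENNReal.ofReal (|x| ^ p) ∂P ≤ ENNReal.ofReal γ) (hA : 0 < A)
    (ha : 0 < a) (haA : a ≤ A ^ p) (he : Real.exp 1 ≤ A ^ p) (hα : α = γ * a / 10)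
    (hαA : 1 / 2 ≤ α * A) :
    ∑' b, ENNReal.ofReal (Real.negMulLog (P.real (tailCell α A ⁻¹' {b}))) ≤
      ENNReal.ofReal (87 / 20 * γ * (Real.log (A ^ p) / A ^ p)) := by
  set B := tailCell α A with hB
  have hBm : Measurable B := measurable_tailCell α A
  have hcm : ∀ b, MeasurableSet (B ⁻¹' {b}) := fun b => hBm (measurableSet_singleton b)
  have hα0 : 0 < α := by rw [hα]; positivity
  have hAp : 0 < A ^ p := Real.rpow_pos_of_pos hA p
  have hL1 : 1 ≤ Real.log (A ^ p) := (Real.le_log_iff_exp_le hAp).2 he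
  set m := α * A with hm
  have hm0 : 0 < m := by positivity
  set D := 15 / 4 * (Real.log (A ^ p) / A ^ p) with hD
  have hD0 : 0 ≤ D := by positivity
  -- Reference weights for the two cells of index `±(k + 1)`: summable in `k`, yet with `log (1 / r
  -- k)` only logarithmic in `|x|` on those cells, so that the `p`-th moment controls it.
  set r : ℕ → ℝ := fun k => γ / A ^ p / 10 * (m / (m + k) ^ 2) with hr
  have hr0 : ∀ k, 0 < r k := fun k => by positivity
  have hcellsum : ∑' b, P (B ⁻¹' {b}) = 1 := by
    rw [← measure_iUnion (fun b b' hbb' => Disjoint.preimage B (by simpa using hbb')) hcm,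
      ← preimage_iUnion, iUnion_of_singleton, preimage_univ, measure_univ]
  -- With reference weight `1`, the core contributes at most the mass outside it. That mass is
  -- absorbed by the linear term `P (B ⁻¹' {b})` in `hterm`.
  have hzero : ENNReal.ofReal (Real.negMulLog (P.real (B ⁻¹' {0}))) ≤
      ∑' b : ℤ, if b = 0 then 0 else P (B ⁻¹' {b}) := by
    rw [tsum_int_eq_add_ite] at hcellsum
    rw [← ENNReal.add_le_add_iff_right (measure_ne_top P (B ⁻¹' {0}))]
    have := ofReal_negMulLog_add_le (prob_le_one (μ := P) (s := B ⁻¹' {0})) one_pos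
    simp only [div_one, Real.log_one, ENNReal.ofReal_zero, zero_mul, zero_add,
      ENNReal.ofReal_one] at this
    rw [measureReal_def]
    refine this.trans ?_
    rw [add_comm, hcellsum]
  have hterm : ∀ b : ℤ, b ≠ 0 →
      P (B ⁻¹' {b}) + ENNReal.ofReal (Real.negMulLog (P.real (B ⁻¹' {b}))) ≤
      ∫⁻ x in B ⁻¹' {b}, ENNReal.ofReal (D * |x| ^ p) ∂P + ENNReal.ofReal (r (b.natAbs - 1)) := by
    intro b hb
    rw [add_comm, measureReal_def]
    refine (ofReal_negMulLog_add_le prob_le_one (hr0 (b.natAbs - 1))).trans ?_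
    gcongr
    rw [← setLIntegral_const]
    refine setLIntegral_mono (by fun_prop) fun x hx => ENNReal.ofReal_le_ofReal ?_
    have hx' : B x = b := hx
    obtain ⟨h1, h2, h3⟩ := tailCell_bounds (α := α) (A := A) (x := x) hα0 (by
      rw [← hB, hx']; exact hb)
    rw [← hB, hx'] at h2 h3
    refine le_trans ?_ (log_mul_sq_div_le hp hA ha haA he h1.le)
    refine Real.log_le_log (by have := hr0 (b.natAbs - 1); positivity) ?_
    have hk : ((b.natAbs - 1 : ℕ) : ℝ) = ((|b| - 1 : ℤ) : ℝ) := by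
      rw [Int.abs_eq_natAbs] at h2 ⊢
      have : ((b.natAbs - 1 : ℕ) : ℤ) = (b.natAbs : ℤ) - 1 := by omega
      exact_mod_cast this
    simp only [hr]
    rw [hk]
    have hk0 : (0 : ℝ) ≤ ((|b| - 1 : ℤ) : ℝ) := by exact_mod_cast (by omega : 0 ≤ |b| - 1)
    set k := ((|b| - 1 : ℤ) : ℝ) with hkdef
    have hsq : (m + k) ^ 2 ≤ (α * |x|) ^ 2 := pow_le_pow_left₀ (by positivity) h3 2
    have e1 : 1 / (γ / A ^ p / 10 * (m / (m + k) ^ 2)) =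
        10 * A ^ p / (γ * m) * (m + k) ^ 2 := by field_simp
    -- Here `α = γ * a / 10` is used; the `10` matches the one in `r`.
    have e2 : a * A ^ p * |x| ^ 2 / A = 10 * A ^ p / (γ * m) * (α * |x|) ^ 2 := by
      rw [hm, hα]; field_simp
    rw [e1, e2]
    gcongr
  have hint : ∑' b, ∫⁻ x in B ⁻¹' {b}, ENNReal.ofReal (D * |x| ^ p) ∂P ≤
      ENNReal.ofReal (D * γ) := by
    rw [← lintegral_iUnion hcm (fun b b' hbb' => Disjoint.preimage B (by simpa using hbb')),
      ← preimage_iUnion, iUnion_of_singleton, preimage_univ, setLIntegral_univ]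
    simp_rw [ENNReal.ofReal_mul hD0]
    rw [lintegral_const_mul _ (by fun_prop)]
    gcongr
  -- The two sides of the line give a factor `2`, and `1 / m + 1 ≤ 3` by `hαA`, so the constant is
  -- `2 * 3 / 10`.
  have hrsum : ∑' b : ℤ, (if b = 0 then 0 else ENNReal.ofReal (r (b.natAbs - 1))) ≤
      ENNReal.ofReal (3 / 5 * (γ / A ^ p)) := by
    rw [tsum_int_eq_two_mul (f := fun k => ENNReal.ofReal (r k))]
    have hu : 0 ≤ γ / A ^ p / 10 := by positivity
    simp only [hr]
    simp_rw [ENNReal.ofReal_mul hu]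
    rw [ENNReal.tsum_mul_left]
    calc 2 * (ENNReal.ofReal (γ / A ^ p / 10) * ∑' k : ℕ, ENNReal.ofReal (m / (m + k) ^ 2))
        ≤ ENNReal.ofReal 2 * (ENNReal.ofReal (γ / A ^ p / 10) * ENNReal.ofReal 3) := by
          gcongr
          · simp
          · refine (tsum_ofReal_div_sq_le hm0).trans (ENNReal.ofReal_le_ofReal ?_)
            have : 1 / m ≤ 2 := by
              rw [div_le_iff₀ hm0]; linarith
            linarith
      _ = ENNReal.ofReal (3 / 5 * (γ / A ^ p)) := by
          rw [← ENNReal.ofReal_mul hu, ← ENNReal.ofReal_mul (by norm_num)]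
          congr 1
          ring
  calc ∑' b, ENNReal.ofReal (Real.negMulLog (P.real (B ⁻¹' {b})))
      = ENNReal.ofReal (Real.negMulLog (P.real (B ⁻¹' {0}))) + ∑' b : ℤ, (if b = 0 then 0 else
          ENNReal.ofReal (Real.negMulLog (P.real (B ⁻¹' {b})))) :=
        tsum_int_eq_add_ite _
    _ ≤ (∑' b : ℤ, if b = 0 then 0 else P (B ⁻¹' {b})) + ∑' b : ℤ, (if b = 0 then 0 else
          ENNReal.ofReal (Real.negMulLog (P.real (B ⁻¹' {b})))) := by gcongr
    _ = ∑' b : ℤ, ((if b = 0 then 0 else P (B ⁻¹' {b})) + (if b = 0 then 0 else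
          ENNReal.ofReal (Real.negMulLog (P.real (B ⁻¹' {b}))))) := ENNReal.tsum_add.symm
    _ ≤ ∑' b : ℤ, (∫⁻ x in B ⁻¹' {b}, ENNReal.ofReal (D * |x| ^ p) ∂P +
          (if b = 0 then 0 else ENNReal.ofReal (r (b.natAbs - 1)))) := by
        refine ENNReal.tsum_le_tsum fun b => ?_
        by_cases hb : b = 0
        · simp [hb]
        · simp only [hb, if_false]
          exact hterm b hb
    _ ≤ ENNReal.ofReal (D * γ) + ENNReal.ofReal (3 / 5 * (γ / A ^ p)) := by
        rw [ENNReal.tsum_add]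
        exact add_le_add hint hrsum
    _ ≤ _ := by
        rw [← ENNReal.ofReal_add (by positivity) (by positivity)]
        refine ENNReal.ofReal_le_ofReal ?_
        -- As `log (A ^ p) ≥ 1`, both terms have the same form, with total constant `15/4 + 3/5 =
        -- 87/20`.
        have h1 : γ / A ^ p ≤ γ * (Real.log (A ^ p) / A ^ p) := by
          rw [mul_div_assoc', mul_comm γ, mul_div_assoc]
          exact le_mul_of_one_le_left (by positivity) hL1
        rw [hD]
        linarith

end TailEntropy

/-! ### The infimum defining the amplitude -/

section Amplitude

open Filter Topology

lemma amplitudeSet_nonempty (PZ : Measure ℝ) {p γ : ℝ} (hp : 1 ≤ p) {t : ℝ≥0∞}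
    (ht : 0 < t) : (amplitudeSet PZ p γ t).Nonempty := by
  have hp0 : 0 < p := by linarith
  have h1 : Tendsto (fun A : ℝ => A ^ p) atTop atTop := tendsto_rpow_atTop hp0
  have h2 : Tendsto (fun x : ℝ => Real.log x / x) atTop (𝓝 0) :=
    Real.isLittleO_log_id_atTop.tendsto_div_nhds_zero
  have h3 : Tendsto (fun A : ℝ => ENNReal.ofReal (18 * γ * (Real.log (A ^ p) / A ^ p))) atTop
      (𝓝 0) := by
    have := ENNReal.tendsto_ofReal ((h2.comp h1).const_mul (18 * γ))
    simpa using this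
  obtain ⟨A, hA1, hA2, hA3⟩ := ((eventually_gt_atTop (0 : ℝ)).and
    ((h3.eventually (eventually_lt_nhds ht)).and (h1.eventually_ge_atTop
      (max (Real.exp 1) (max (2 * γ) (alphaStar PZ * Real.exp 3 / γ)))))).exists
  refine ⟨A, hA1, ?_, hA3⟩
  rw [Real.rpow_neg hA1.le, mul_assoc, inv_mul_eq_div]
  exact hA2.le

/-- The lower bound on `A ^ p` keeps `A` away from `0`, where the other condition could fail to be
continuous. The set is therefore closed, and both conditions hold at `A₂^*` itself. -/
lemma amplitudeStar_mem (PZ : Measure ℝ) {p γ : ℝ} (hp : 1 ≤ p) {t : ℝ≥0∞} (ht : 0 < t) :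
    amplitudeStar PZ p γ t ∈ amplitudeSet PZ p γ t := by
  have hp0 : 0 < p := by linarith
  set M := max (Real.exp 1) (max (2 * γ) (alphaStar PZ * Real.exp 3 / γ)) with hM
  have hM0 : 0 < M := lt_max_of_lt_left (Real.exp_pos 1)
  have hδ : 0 < M ^ p⁻¹ := Real.rpow_pos_of_pos hM0 _
  have heq : amplitudeSet PZ p γ t = Ici (M ^ p⁻¹) ∩
      (fun A : ℝ => ENNReal.ofReal (18 * γ * A ^ (-p) * Real.log (A ^ p))) ⁻¹' Iic t := by
    ext A
    constructor
    · rintro ⟨h1, h2, h3⟩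
      exact ⟨(Real.rpow_inv_le_iff_of_pos hM0.le h1.le hp0).2 h3, h2⟩
    · rintro ⟨h1, h2⟩
      have hA : 0 < A := hδ.trans_le h1
      exact ⟨hA, h2, (Real.rpow_inv_le_iff_of_pos hM0.le hA.le hp0).1 h1⟩
  have hcl : IsClosed (amplitudeSet PZ p γ t) := by
    rw [heq]
    refine ContinuousOn.preimage_isClosed_of_isClosed ?_ isClosed_Ici isClosed_Iic
    refine ENNReal.continuous_ofReal.comp_continuousOn ?_
    have hne : ∀ A ∈ Ici (M ^ p⁻¹), A ≠ 0 := fun A hA => (hδ.trans_le hA).ne'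
    refine (continuousOn_const.mul (continuousOn_id.rpow_const fun A hA => Or.inl (hne A hA))).mul
      (ContinuousOn.log (continuousOn_id.rpow_const fun A hA => Or.inl (hne A hA)) fun A hA => ?_)
    exact (Real.rpow_pos_of_pos (hδ.trans_le hA) p).ne'
  exact hcl.csInf_mem (amplitudeSet_nonempty PZ hp ht) ⟨0, fun A hA => hA.1.le⟩

end Amplitude

/-! ### Assembly -/

/-- With `H ≤ t / 4`, the case `e = η` gives the coefficient `e + (1 - e) / 4 + (1 - e) / 2 ≤ 1`.
The case `e = 1/3` gives at most `1/3 + 1/6 + 1/2 = 1`, which explains the threshold `1/3` and the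
factor `1/2` in the gap. -/
lemma add_diagonal_gap_le {I t η e H : ℝ≥0∞} (ht : t ≠ ∞) (he : e = max η (1 / 3))
    (hη : η < 1) (hH : 4 * H ≤ t) (hI : I ≤ e * t + (1 - e) * H) :
    I + 1 / 2 * (1 - η) * t ≤ t := by
  have hηt : η ≠ ∞ := hη.ne_top
  have hHt : H ≠ ∞ := by
    rintro rfl
    rw [ENNReal.mul_top (by norm_num)] at hH
    exact ht (top_le_iff.1 hH)
  have he1 : e ≤ 1 := he ▸ max_le hη.le (by simp)
  have het : e ≠ ∞ := ne_top_of_le_ne_top ENNReal.one_ne_top he1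
  have h3 : (1 / 3 : ℝ≥0∞).toReal = 1 / 3 := by simp
  have h3t : (1 / 3 : ℝ≥0∞) ≠ ∞ := by simp
  have heη : η.toReal ≤ e.toReal := ENNReal.toReal_mono het (he ▸ le_max_left _ _)
  have hecases : e.toReal = η.toReal ∨ e.toReal = 1 / 3 := by
    rcases max_choice η (1 / 3) with h | h
    · left; rw [he, h]
    · right; rw [he, h, h3]
  have he3 : 1 / 3 ≤ e.toReal := h3 ▸ ENNReal.toReal_mono het (he ▸ le_max_right _ _)
  have he1' : e.toReal ≤ 1 := ENNReal.toReal_le_of_le_ofReal zero_le_one (by simpa using he1)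
  have hη0 : 0 ≤ η.toReal := ENNReal.toReal_nonneg
  have ht0 : 0 ≤ t.toReal := ENNReal.toReal_nonneg
  have hH' : 4 * H.toReal ≤ t.toReal := by
    have := ENNReal.toReal_mono ht hH
    rwa [ENNReal.toReal_mul] at this
  calc I + 1 / 2 * (1 - η) * t ≤ e * t + (1 - e) * H + 1 / 2 * (1 - η) * t := by gcongr
    _ = ENNReal.ofReal (e.toReal * t.toReal + (1 - e.toReal) * H.toReal +
          1 / 2 * (1 - η.toReal) * t.toReal) := by
        have g1 : (1 - e) = ENNReal.ofReal (1 - e.toReal) := by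
          rw [ENNReal.ofReal_sub _ ENNReal.toReal_nonneg, ENNReal.ofReal_toReal het,
            ENNReal.ofReal_one]
        have g2 : (1 - η) = ENNReal.ofReal (1 - η.toReal) := by
          rw [ENNReal.ofReal_sub _ ENNReal.toReal_nonneg, ENNReal.ofReal_toReal hηt,
            ENNReal.ofReal_one]
        have hη1 : 0 ≤ 1 - η.toReal := by linarith
        have he0 : 0 ≤ 1 - e.toReal := by linarith
        have hHn : 0 ≤ H.toReal := ENNReal.toReal_nonneg
        have hen : 0 ≤ e.toReal := ENNReal.toReal_nonneg
        rw [ENNReal.ofReal_add (by positivity) (by positivity),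
          ENNReal.ofReal_add (by positivity) (by positivity), ENNReal.ofReal_mul hen,
          ENNReal.ofReal_mul he0, ENNReal.ofReal_mul (by positivity),
          ENNReal.ofReal_mul (by norm_num), ENNReal.ofReal_toReal het, ENNReal.ofReal_toReal ht,
          ENNReal.ofReal_toReal hHt, ← g1, ← g2, ENNReal.ofReal_div_of_pos (by norm_num)]
        simp
    _ ≤ ENNReal.ofReal t.toReal := by
        refine ENNReal.ofReal_le_ofReal ?_
        have h5 : (1 - e.toReal) * H.toReal ≤ (1 - e.toReal) * (t.toReal / 4) :=
          mul_le_mul_of_nonneg_left (by linarith) (by linarith)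
        rcases hecases with h | h
        · rw [h] at h5 ⊢
          nlinarith
        · rw [h] at h5 ⊢
          nlinarith
    _ = t := ENNReal.ofReal_toReal ht

lemma klContraction_le_of_alphaStar_lt {PZ : Measure ℝ} (hne : (alphaSet PZ).Nonempty) {α : ℝ}
    (hα : alphaStar PZ < α) : klContraction PZ (1 / (2 * α)) ≤ 1 / 3 := by
  obtain ⟨β, ⟨hβ0, hβ⟩, hβα⟩ := exists_lt_of_csInf_lt hne hα
  refine (klContraction_mono PZ ?_).trans hβ
  exact one_div_le_one_div_of_le (by linarith) (by linarith)

theorem mainTheorem3 {Ω 𝒲 : Type*} [MeasurableSpace Ω] [MeasurableSpace 𝒲]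
    (μ : Measure Ω) [IsProbabilityMeasure μ]
    (W : Ω → 𝒲) (X Z Y : Ω → ℝ) (hW : Measurable W) (hX : Measurable X) (hZ : Measurable Z)
    (hY : ∀ ω, Y ω = X ω + Z ω)
    (hXZ : IndepFun X Z μ)
    (hWXY : IsMarkovChain W X Y μ)
    (hZac : μ.map Z ≪ volume)
    (p γ : ℝ) (hp : 1 ≤ p) (hγ : 0 < γ)
    (hmom : ∫⁻ ω, ENNReal.ofReal (|X ω| ^ p) ∂μ ≤ ENNReal.ofReal γ) :
    (alphaSet (μ.map Z)).Nonempty ∧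
    (∀ t : ℝ≥0∞, 0 < t → (amplitudeSet (μ.map Z) p γ t).Nonempty) ∧
    mutualInfo W Y μ + diagonalGap (μ.map Z) p γ (mutualInfo W X μ) ≤ mutualInfo W X μ := by
  have := Measure.isProbabilityMeasure_map (μ := μ) hZ.aemeasurable
  have := Measure.isProbabilityMeasure_map (μ := μ) hX.aemeasurable
  set PZ := μ.map Z with hPZ
  have hne := alphaSet_nonempty PZ hZac
  refine ⟨hne, fun t ht => amplitudeSet_nonempty PZ hp ht, ?_⟩
  have hdpi := hWXY.mutualInfo_le hW hX hZ hY hXZ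
  set t := mutualInfo W X μ with ht
  rcases eq_or_ne t ∞ with htop | htop
  · rw [htop]; exact le_top
  rcases eq_or_ne t 0 with h0 | h0
  · rw [diagonalGap, h0, mul_zero, add_zero, ← h0]
    exact hdpi
  rw [diagonalGap]
  obtain ⟨hA0, hAt, hAM⟩ := amplitudeStar_mem PZ (γ := γ) hp (pos_iff_ne_zero.2 h0)
  set A := amplitudeStar PZ p γ t with hA
  -- If `η ≥ 1`, truncated subtraction makes the gap zero and data processing suffices.
  rcases le_or_gt 1 (klContraction PZ A) with hη | hη
  · rw [tsub_eq_zero_of_le hη, mul_zero, zero_mul, add_zero]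
    exact hdpi
  set a := A ^ p with ha
  have ha0 : 0 < a := Real.rpow_pos_of_pos hA0 p
  have hea : Real.exp 1 ≤ a := (le_max_left _ _).trans hAM
  set α := γ * a / 10 with hα
  have hα0 : 0 < α := by positivity
  -- The condition `α^* e^3 / γ ≤ A^p` gives `α^* e^3 ≤ 10 α`, and `e^3 > 10`. Strictness matters
  -- because the infimum `α^*` need not be attained.
  have hstar : alphaStar PZ < α := by
    have h1 : alphaStar PZ * Real.exp 3 / γ ≤ a :=
      (le_max_right _ _).trans ((le_max_right _ _).trans hAM)
    rw [div_le_iff₀ hγ] at h1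
    have h3 : (10 : ℝ) < Real.exp 3 := by
      have h4 : Real.exp 3 = Real.exp 1 ^ 3 := by rw [← Real.exp_nat_mul]; norm_num
      have h5 : (2.7 : ℝ) ^ 3 ≤ Real.exp 1 ^ 3 :=
        pow_le_pow_left₀ (by norm_num) (by linarith [Real.exp_one_gt_d9]) 3
      rw [h4]
      norm_num at h5 ⊢
      linarith
    by_contra! hc
    have h6 : α * Real.exp 3 ≤ alphaStar PZ * Real.exp 3 := by gcongr
    have h7 : α * 10 < α * Real.exp 3 := by gcongr
    rw [hα] at h6 h7
    linarith
  have hthird := klContraction_le_of_alphaStar_lt hne hstar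
  -- Enlarging the core secures `α A' ≥ 1/2`, needed for the entropy bound. It does not spoil the
  -- contraction: either `A' = A`, or `A'` is the radius `1 / (2α)` with coefficient at most `1/3`.
  set A' := max A (1 / (2 * α)) with hA'
  have hAA' : A ≤ A' := le_max_left _ _
  have hA'0 : 0 < A' := hA0.trans_le hAA'
  have haA' : a ≤ A' ^ p := Real.rpow_le_rpow hA0.le hAA' (by linarith)
  have hαA' : 1 / 2 ≤ α * A' := by
    have h1 : α * (1 / (2 * α)) = 1 / 2 := by field_simp
    rw [← h1]
    gcongr
    exact le_max_right _ _
  set e := max (klContraction PZ A) (1 / 3) with he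
  have he1 : e ≤ 1 := max_le hη.le (by simp)
  have hA'e : klContraction PZ A' ≤ e := by
    rcases max_choice A (1 / (2 * α)) with h | h
    · rw [hA', h]; exact le_max_left _ _
    · rw [hA', h]; exact hthird.trans (le_max_right _ _)
  have hcell : ∀ b, ∀ P' Q' : Measure ℝ, IsProbabilityMeasure P' → IsProbabilityMeasure Q' →
      P' (tailCell α A' ⁻¹' {b}) = 1 → Q' (tailCell α A' ⁻¹' {b}) = 1 → klDiv P' Q' ≠ ∞ →
      klDiv (P'.conv PZ) (Q'.conv PZ) ≤ e * klDiv P' Q' := by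
    intro b P' Q' _ _ hP' hQ' hfin
    have hone : ∀ (M : Measure ℝ) (s : Set ℝ), IsProbabilityMeasure M →
        M (tailCell α A' ⁻¹' {b}) = 1 → tailCell α A' ⁻¹' {b} ⊆ s → M s = 1 :=
      fun M s _ h hs => le_antisymm prob_le_one (h ▸ measure_mono hs)
    by_cases hb : b = 0
    · subst hb
      have hs := tailCell_preimage_zero (A := A') hα0
      refine (klDiv_conv_le_klContraction_mul PZ A' 0 P' Q' (hone _ _ inferInstance hP' hs)
        (hone _ _ inferInstance hQ' hs) hfin).trans ?_
      gcongr
    · obtain ⟨c, hs⟩ := exists_tailCell_preimage_subset (A := A') hα0 hb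
      refine (klDiv_conv_le_klContraction_mul PZ _ c P' Q' (hone _ _ inferInstance hP' hs)
        (hone _ _ inferInstance hQ' hs) hfin).trans ?_
      gcongr
      exact hthird.trans (le_max_right _ _)
  have hI := hWXY.mutualInfo_le_of_partition hW hX hZ hY hXZ (measurable_tailCell α A') he1
    hcell htop
  have hmomX : ∫⁻ x, ENNReal.ofReal (|x| ^ p) ∂(μ.map X) ≤ ENNReal.ofReal γ := by
    rwa [lintegral_map (by fun_prop) hX]
  have hH := entropy_tailCell_le (μ.map X) hp hγ hmomX hA'0 ha0 haA' (hea.trans haA') hα hαA'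
  refine add_diagonal_gap_le htop he hη ?_ hI
  refine le_trans ?_ hAt
  calc 4 * ∑' b, ENNReal.ofReal (Real.negMulLog ((μ.map X).real (tailCell α A' ⁻¹' {b})))
      ≤ ENNReal.ofReal 4 *
          ENNReal.ofReal (87 / 20 * γ * (Real.log (A' ^ p) / A' ^ p)) := by
        gcongr
        simp
    _ = ENNReal.ofReal (4 * (87 / 20 * γ * (Real.log (A' ^ p) / A' ^ p))) :=
        (ENNReal.ofReal_mul (by norm_num)).symm
    _ ≤ _ := by
        refine ENNReal.ofReal_le_ofReal ?_
        -- `log x / x` decreases on `[e, ∞)`, so the bound at `A'` passes to `A`. The final constant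
        -- is `4 * 87/20 = 17.4 ≤ 18`.
        have h1 : Real.log (A' ^ p) / A' ^ p ≤ Real.log a / a :=
          Real.log_div_self_antitoneOn hea (hea.trans haA') haA'
        have h2 : 0 ≤ Real.log a / a :=
          div_nonneg (Real.log_nonneg (by linarith [Real.add_one_le_exp (1 : ℝ)])) ha0.le
        rw [Real.rpow_neg hA0.le, mul_assoc (18 * γ), inv_mul_eq_div]
        have h3 : γ * (Real.log (A' ^ p) / A' ^ p) ≤ γ * (Real.log a / a) := by gcongr
        have h4 : 0 ≤ γ * (Real.log a / a) := by positivity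
        linarith
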